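/- Let $r\ge 1$ and $0\le a\le r$ be coprime integers (so $0<a<r$, or $r=1$ and the group below is trivial), and let $G=\{\mathrm{diag}(\epsilon,\epsilon^a,\epsilon^{r-a}) : \epsilon^r=1\}\subset GL_3(\mathbb C)$, the group of type $\frac1r(1,a,r-a)$. Let $L=\mathbb Z^3+\mathbb Z\cdot\frac1r(1,a,r-a)\subset\mathbb R^3$, and let $M=\mathrm{Hom}(L,\mathbb Z)$, viewed as the lattice of $G$-invariant Laurent monomials in $x,y,z$. For $1\le i<r$ put $v_i=\frac1r(i,\overline{ai},\overline{r-ai})\in L$, where the bar denotes the residue modulo $r$ in $\{0,\dots,r-1\}$. The fan of the economic resolution of $\mathbb C^3/G$ is obtained from the fan of faces of $\mathrm{Cone}(e_1,e_2,e_3)$ by consecutive star subdivisions (weighted blowups) at $v_1,v_2,\dots,v_{r-1}$; let $\Sigma_{\max}$ be the set of its maximal cones. The weight of a Laurent monomial is the character by which $G$ acts on it. A $G$-prebrick is a set $\Gamma$ of Laurent monomials such that: (i) $1\in\Gamma$; (ii) every character of $G$ is the weight of exactly one element of $\Gamma$; (iii) if $n'nm\in\Gamma$ with $m\in\Gamma$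 and genuine monomials $n,n'$, then $nm\in\Gamma$; (iv) every element of $\Gamma$ is joined to $1$ by a path in $\Gamma$ whose steps multiply or divide by one of $x,y,z$. Let $S(\Gamma)\subset M$ be the subsemigroup generated by all $nm/\mathrm{wt}_\Gamma(nm)$ with $n$ a genuine monomial and $m\in\Gamma$, where $\mathrm{wt}_\Gamma(nm)$ is the element of $\Gamma$ of the same weight as $nm$, and let $U(\Gamma)=\mathrm{Spec}\,\mathbb C[S(\Gamma)]$. A $G$-brick is a $G$-prebrick $\Gamma$ for which $U(\Gamma)$ has a point fixed by the torus $\mathrm{Spec}\,\mathbb C[M]$. Define recursively a set $\mathfrak G(r,a)$ of sets of Laurent monomials, the Danilov bricks. If $r=1$, then $\mathfrak G(r,a)=\{\{1\}\}$. If $0<a<r$, put $f(m)=\lfloor (m_1+am_2+(r-a)m_3)/r\rfloor$ and let $\phi_1,\phi_2,\phi_3$ be the central, left and right round-down functions, which send a monomial with exponent vector $(m_1,m_2,m_3)$ to the monomial (in new coordinates $\xi,\eta,\zeta$) with exponent vector $(f(m),m_2,m_3)$, $(m_1,f(m),m_3)$, $(m_1,m_2,f(m))$ respectively. Then $\mathfrak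 G(r,a)$ consists of $\phi_1^{-1}(\{1\})$, of the sets $\phi_2^{-1}(\Gamma')$ for $\Gamma'\in\mathfrak G(a,b)$, and of the sets $\phi_3^{-1}(\Gamma')$ for $\Gamma'\in\mathfrak G(r-a,c)$, where $b\in\{0,\dots,a-1\}$ is the residue of $-r$ modulo $a$ and $c\in\{0,\dots,r-a-1\}$ is the residue of $r$ modulo $r-a$. Then every element of $\mathfrak G(r,a)$ is a $G$-brick, and there is a bijection $\Sigma_{\max}\to\mathfrak G(r,a)$, $\sigma\mapsto\Gamma_\sigma$, such that $S(\Gamma_\sigma)=\sigma^\vee\cap M$ for every $\sigma\in\Sigma_{\max}$. In particular, for every $\sigma\in\Sigma_{\max}$, the affine toric variety $U_\sigma=\mathrm{Spec}\,\mathbb C[\sigma^\vee\cap M]$ is smooth over $\mathbb C$ and $U(\Gamma_\sigma)\cong U_\sigma$ over $\mathbb C$. -/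

import Mathlib

open CategoryTheory AlgebraicGeometry

namespace EconBrick

noncomputable section

/-! ## Monomials, the group, the lattices -/

/-- Laurent monomials in `x, y, z`, written additively through their exponent vectors: the
monomial `x^{m₀} y^{m₁} z^{m₂}` is `![m₀, m₁, m₂]`, and `1` is `0`. -/
abbrev LMono : Type := Fin 3 → ℤ

/-- The space `L_ℝ = ℝ³`. -/
abbrev LR : Type := Fin 3 → ℝ

/-- The pairing of a point of `ℝ³` with the exponent vector of a Laurent monomial. -/
def pairing (u : LR) (m : LMono) : ℝ := ∑ i, u i * (m i : ℝ)

/-- The group of type `(1/r)(α₀, α₁, α₂)`: all diagonal matrices `diag(ε^α₀, ε^α₁, ε^α₂)` with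
`ε^r = 1`, as a subgroup of the group `(ℂˣ)³` of invertible diagonal `3 × 3` matrices. -/
def groupOfType (r : ℕ) (α : Fin 3 → ℤ) : Subgroup (Fin 3 → ℂˣ) where
  carrier := {g | ∃ ε : ℂˣ, ε ^ r = 1 ∧ ∀ i, g i = ε ^ α i}
  one_mem' := ⟨1, by simp, by simp⟩
  mul_mem' := by
    rintro g h ⟨ε, hε, hg⟩ ⟨δ, hδ, hh⟩
    exact ⟨ε * δ, by rw [mul_pow, hε, hδ, one_mul], fun i => by
      rw [Pi.mul_apply, hg, hh, mul_zpow]⟩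
  inv_mem' := by
    rintro g ⟨ε, hε, hg⟩
    exact ⟨ε⁻¹, by rw [inv_pow, hε, inv_one], fun i => by rw [Pi.inv_apply, hg, inv_zpow]⟩

/-- The character of the diagonal torus given by a Laurent monomial. -/
def monoChar (m : LMono) : (Fin 3 → ℂˣ) →* ℂˣ where
  toFun t := ∏ i, t i ^ m i
  map_one' := by simp
  map_mul' s t := by simp [mul_zpow, Finset.prod_mul_distrib]

/-- The weight of a Laurent monomial: the character of `G` by which `G` acts on it, an element of
the character group `Hom(G, ℂˣ)`. -/
def wt (r : ℕ) (α : Fin 3 → ℤ) (m : LMono) : groupOfType r α →* ℂˣ :=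
  (monoChar m).comp (groupOfType r α).subtype

/-- The lattice `L = ℤ³ + ℤ · (1/r)(α₀, α₁, α₂)` in `ℝ³`. -/
def latticeL (r : ℕ) (α : Fin 3 → ℤ) : AddSubgroup LR :=
  AddSubgroup.closure
    (insert (fun i => (α i : ℝ) / r) (Set.range fun j : Fin 3 => (Pi.single j 1 : LR)))

/-- The dual lattice `M = Hom(L, ℤ)`, as the subgroup of those Laurent monomials whose pairing
with every point of `L` is an integer. -/
def latticeM (r : ℕ) (α : Fin 3 → ℤ) : AddSubgroup LMono where
  carrier := {m | ∀ u ∈ latticeL r α, ∃ k : ℤ, pairing u m = k}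
  zero_mem' := fun u _ => ⟨0, by simp [pairing]⟩
  add_mem' := by
    intro m n hm hn u hu
    obtain ⟨k, hk⟩ := hm u hu
    obtain ⟨l, hl⟩ := hn u hu
    refine ⟨k + l, ?_⟩
    push_cast
    rw [← hk, ← hl]
    simp [pairing, mul_add, Finset.sum_add_distrib]
  neg_mem' := by
    intro m hm u hu
    obtain ⟨k, hk⟩ := hm u hu
    refine ⟨-k, ?_⟩
    push_cast
    rw [← hk]
    simp [pairing]

/-! ## `G`-prebricks and `G`-bricks -/

/-- One step of a path in `Γ`: multiply or divide by one of `x, y, z`, staying in `Γ`. -/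
def Step (Γ : Set LMono) (p q : LMono) : Prop :=
  p ∈ Γ ∧ q ∈ Γ ∧ ∃ i : Fin 3, q = p + Pi.single i 1 ∨ q = p - Pi.single i 1

/-- `G`-prebricks, for the group `G` of type `(1/r)(α₀, α₁, α₂)`. -/
structure IsGPrebrick (r : ℕ) (α : Fin 3 → ℤ) (Γ : Set LMono) : Prop where
  /-- The monomial `1` lies in `Γ`. -/
  one_mem : (0 : LMono) ∈ Γ
  /-- Every character of `G` is the weight of exactly one element of `Γ`. -/
  weights : Set.BijOn (wt r α) Γ Set.univ
  /-- If `n' · n · m ∈ Γ` with `m ∈ Γ` and genuine monomials `n, n'`, then `n · m ∈ Γ`. -/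
  convex : ∀ m ∈ Γ, ∀ n n' : LMono, 0 ≤ n → 0 ≤ n' → n' + n + m ∈ Γ → n + m ∈ Γ
  /-- Every element of `Γ` is joined to `1` by a path in `Γ`. -/
  connected : ∀ m ∈ Γ, Relation.ReflTransGen (Step Γ) m 0

/-- The semigroup `S(Γ)`: the subsemigroup of `M` generated by all quotients
`n · m / wt_Γ(n · m)` with `n` a genuine monomial and `m ∈ Γ`, where `wt_Γ(n · m)` is the element
`m'` of `Γ` of the same weight as `n · m`. (The quotient `1` is among the generators, so the
generated subsemigroup and the generated submonoid agree.) -/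
def semigroupS (r : ℕ) (α : Fin 3 → ℤ) (Γ : Set LMono) : AddSubmonoid (latticeM r α) :=
  AddSubmonoid.closure {d | ∃ n : LMono, 0 ≤ n ∧ ∃ m ∈ Γ, ∃ m' ∈ Γ,
    wt r α m' = wt r α (n + m) ∧ (d : LMono) = n + m - m'}

/-- For a subsemigroup `S` of `M`, a point `t` of the torus `Spec ℂ[M]`, that is, a homomorphism
`M → ℂˣ`, acts on `ℂ[S]` by multiplying the monomial `s` by `t(s)`. -/
def torusAct {M : AddSubgroup LMono} (S : AddSubmonoid M) (t : Multiplicative M →* ℂˣ) :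
    AddMonoidAlgebra ℂ S →ₐ[ℂ] AddMonoidAlgebra ℂ S :=
  AddMonoidAlgebra.lift ℂ (AddMonoidAlgebra ℂ S) S
    { toFun := fun s => AddMonoidAlgebra.single s.toAdd
        ((t (Multiplicative.ofAdd (s.toAdd : M)) : ℂˣ) : ℂ)
      map_one' := by
        simp [AddMonoidAlgebra.one_def]
      map_mul' := fun a b => by
        simp [AddMonoidAlgebra.single_mul_single] }

/-- The affine toric variety `Spec ℂ[S]` has a torus fixed point: some `ℂ`-point of it, that is,
some `ℂ`-algebra homomorphism `ℂ[S] → ℂ`, is fixed by every point of the torus `Spec ℂ[M]`. -/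
def HasTorusFixedPoint {M : AddSubgroup LMono} (S : AddSubmonoid M) : Prop :=
  ∃ p : AddMonoidAlgebra ℂ S →ₐ[ℂ] ℂ, ∀ t : Multiplicative M →* ℂˣ, p.comp (torusAct S t) = p

/-- `G`-bricks: the `G`-prebricks `Γ` for which `U(Γ) = Spec ℂ[S(Γ)]` has a torus fixed point. -/
def IsGBrick (r : ℕ) (α : Fin 3 → ℤ) (Γ : Set LMono) : Prop :=
  IsGPrebrick r α Γ ∧ HasTorusFixedPoint (semigroupS r α Γ)

/-- The affine scheme `Spec ℂ[S]` over `Spec ℂ`. -/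
def affineToric {M : AddSubgroup LMono} (S : AddSubmonoid M) :
    Over (Spec (CommRingCat.of ℂ)) :=
  Over.mk (Spec.map (CommRingCat.ofHom (algebraMap ℂ (AddMonoidAlgebra ℂ S))))

/-! ## Cones, fans, the economic resolution -/

/-- The semigroup `σ^∨ ∩ M`. -/
def dualSemigroup (M : AddSubgroup LMono) (σ : PointedCone ℝ LR) : AddSubmonoid M where
  carrier := {m | ∀ u ∈ σ, 0 ≤ pairing u m}
  zero_mem' := fun u _ => by simp [pairing]
  add_mem' := by
    intro m n hm hn u hu
    have h : pairing u ((m + n : M) : LMono) = pairing u m + pairing u n := by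
      simp [pairing, mul_add, Finset.sum_add_distrib]
    rw [h]
    exact add_nonneg (hm u hu) (hn u hu)

/-- The fan of all faces of the cone `σ₊` generated by `e₁, e₂, e₃`. -/
def orthantFan : Set (PointedCone ℝ LR) :=
  {τ | ∃ I : Set (Fin 3), τ = PointedCone.hull ℝ ((fun i => (Pi.single i 1 : LR)) '' I)}

/-- The barycentric (star) subdivision of a fan `F` at a point `v`, the fan of the weighted blowup
at `v`: it consists of the cones of `F` that do not contain `v` and of the cones `Cone(τ, v)`,
where `τ ∈ F` does not contain `v` and is contained in a cone of `F` that does. -/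
def starSubdivision (F : Set (PointedCone ℝ LR)) (v : LR) : Set (PointedCone ℝ LR) :=
  {τ | τ ∈ F ∧ v ∉ τ} ∪
    {ρ | ∃ τ ∈ F, v ∉ τ ∧ (∃ σ ∈ F, τ ≤ σ ∧ v ∈ σ) ∧ ρ = τ ⊔ PointedCone.hull ℝ {v}}

/-- The lattice point `v_i = (1/r)(i, residue of a i, residue of r - a i)`, residues modulo `r`
taken in `{0, …, r - 1}`. -/
def econPoint (r a i : ℕ) : LR :=
  ![(i : ℝ) / r, (((a * i : ℤ) % (r : ℤ) : ℤ) : ℝ) / r, (((r - a * i : ℤ) % (r : ℤ) : ℤ) : ℝ) / r]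

/-- The fan after the first `k` weighted blowups, at `v_1, …, v_k`. -/
def blowupFan (r a : ℕ) : ℕ → Set (PointedCone ℝ LR)
  | 0 => orthantFan
  | k + 1 => starSubdivision (blowupFan r a k) (econPoint r a (k + 1))

/-- The fan of the economic resolution of `ℂ³/G`, where `G` is of type `(1/r)(1, a, r - a)`:
consecutive weighted blowups at `v_1, …, v_{r-1}`. -/
def econFan (r a : ℕ) : Set (PointedCone ℝ LR) := blowupFan r a (r - 1)

/-- The maximal cones of the fan of the economic resolution. -/
def maxCones (r a : ℕ) : Set (PointedCone ℝ LR) := {σ | Maximal (· ∈ econFan r a) σ}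

/-! ## Round down functions and Danilov bricks -/

/-- The weights `(1, a, r - a)`. -/
def danilovType (r a : ℕ) : Fin 3 → ℤ := ![1, a, r - a]

/-- The integer `⌊(m₀ + a m₁ + (r - a) m₂) / r⌋` (integer division by a positive integer is the
floor of the quotient). -/
def floorWt (r a : ℕ) (m : LMono) : ℤ := (m 0 + a * m 1 + (r - a) * m 2) / r

/-- The central round down function, in the coordinates `ξ₁, η₁, ζ₁` of `M₁`. -/
def roundDownCentral (r a : ℕ) (m : LMono) : LMono := ![floorWt r a m, m 1, m 2]

/-- The left round down function, in the coordinates `ξ₂, η₂, ζ₂` of `M₂`. -/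
def roundDownLeft (r a : ℕ) (m : LMono) : LMono := ![m 0, floorWt r a m, m 2]

/-- The right round down function, in the coordinates `ξ₃, η₃, ζ₃` of `M₃`. -/
def roundDownRight (r a : ℕ) (m : LMono) : LMono := ![m 0, m 1, floorWt r a m]

/-- The set of Danilov bricks for the group of type `(1/r)(1, a, r - a)`, by recursion. For the
trivial group the only one is `{1}`. For `0 < a < r` they are: the preimage of `{1}` under the
central round down function; the preimages, under the left round down function, of those of the
group of type `(1/a)(1, -r, r)`; and the preimages, under the right round down function, of those
of the group of type `(1/(r-a))(1, r, -r)`. -/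
inductive IsDanilovBrick : ℕ → ℕ → Set LMono → Prop
  | trivial (a : ℕ) : IsDanilovBrick 1 a {0}
  | central (r a : ℕ) (h0 : 0 < a) (h1 : a < r) :
      IsDanilovBrick r a (roundDownCentral r a ⁻¹' {0})
  | left (r a b : ℕ) (h0 : 0 < a) (h1 : a < r) (hb : b < a) (hbr : (b : ℤ) ≡ -r [ZMOD a])
      (Γ' : Set LMono) (h : IsDanilovBrick a b Γ') :
      IsDanilovBrick r a (roundDownLeft r a ⁻¹' Γ')
  | right (r a c : ℕ) (h0 : 0 < a) (h1 : a < r) (hc : c < r - a)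
      (hcr : (c : ℤ) ≡ r [ZMOD (r - a : ℤ)])
      (Γ' : Set LMono) (h : IsDanilovBrick (r - a) c Γ') :
      IsDanilovBrick r a (roundDownRight r a ⁻¹' Γ')

/-- The set `𝔊(r, a)` of Danilov bricks. -/
def danilovBricks (r a : ℕ) : Set (Set LMono) := {Γ | IsDanilovBrick r a Γ}

end

end EconBrick

open EconBrick

namespace EconBrick

noncomputable section

/-! ## Weights and the lattice `M` -/

/-! Both sides obey the same recursion, and the proof runs it on cones and bricks at once. The
blowup at `v_1` cuts the orthant into three charts: chart `j` replaces `e_j` by `v_1 = α / r`, which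
is the linear map `subdivMap`. On the lattice `M` its transpose is the round down function
`roundDown` (`pairing_subdivMap`), which carries `M` isomorphically onto the lattice of a smaller
group of the same shape: trivial for the central chart, of order `a` for the left, of order `r - a`
for the right (`IsChart.isRoundDown`).

On the brick side, a round down function is monotone, additive along `M`, has connected fibres, and
lifts each elementary step between monomials. These properties alone make preimages of prebricks
prebricks (`isGPrebrick_preimage`) and identify their semigroups `S` under the lattice isomorphism
(`mem_semigroupS_preimage_iff`). So a pair with `S(Γ) = σ^∨ ∩ M` stays such a pair when `σ` is
mapped by `subdivMap` and `Γ` is pulled back (`IsBrickPair.subdiv`), starting from the orthant and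
`{1}`. That `σ^∨ ∩ M` is `ℕ³` is inherited too, and gives both the torus fixed point and smoothness.

On the fan side, every later centre `v_n` lies in the interior of the left or the right chart and is
there a centre of the smaller resolution (`econPoint_left`, `econPoint_right`). Such a blowup
changes nothing outside its chart (`starSubdivision_glue`), so the economic fan is glued from the
orthant and two smaller economic fans (`econFan_eq_glue`). Hence its maximal cones are the cones of
the recursion tree (`mem_maxCones_iff`). The correspondence with bricks is one-to-one because the
dual semigroup determines the cone (`cone_eq`), and the cone determines its path in the tree
(`brick_eq`). -/

theorem mem_latticeM {r : ℕ} (hr : 0 < r) (α : Fin 3 → ℤ) (m : LMono) :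
    m ∈ latticeM r α ↔ (r : ℤ) ∣ dotProduct α m := by
  have hr' : (r : ℝ) ≠ 0 := by positivity
  have hv : pairing (fun i => (α i : ℝ) / r) m = ((dotProduct α m : ℤ) : ℝ) / r := by
    simp only [pairing, dotProduct, Int.cast_sum, Int.cast_mul, Finset.sum_div]
    exact Finset.sum_congr rfl fun i _ => by ring
  constructor
  · intro h
    obtain ⟨k, hk⟩ := h _ (AddSubgroup.subset_closure (Set.mem_insert _ _))
    rw [hv, div_eq_iff hr'] at hk
    exact ⟨k, by rw [mul_comm]; exact_mod_cast hk⟩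
  · rintro ⟨k, hk⟩ u hu
    induction hu using AddSubgroup.closure_induction with
    | mem u hu =>
      rcases hu with rfl | ⟨j, rfl⟩
      · exact ⟨k, by rw [hv, hk, Int.cast_mul, Int.cast_natCast, mul_div_cancel_left₀ _ hr']⟩
      · exact ⟨m j, by simp [pairing, Pi.single_apply]⟩
    | zero => exact ⟨0, by simp [pairing]⟩
    | add u v _ _ hu hv =>
      obtain ⟨k, hk⟩ := hu
      obtain ⟨l, hl⟩ := hv
      refine ⟨k + l, ?_⟩
      push_cast
      rw [← hk, ← hl]
      simp [pairing, add_mul, Finset.sum_add_distrib]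
    | neg u _ hu =>
      obtain ⟨k, hk⟩ := hu
      refine ⟨-k, ?_⟩
      push_cast
      rw [← hk]
      simp [pairing]

theorem wt_apply_of_eq {r : ℕ} {α : Fin 3 → ℤ} (m : LMono) (g : groupOfType r α) {ε : ℂˣ}
    (hg : ∀ i, (g : Fin 3 → ℂˣ) i = ε ^ α i) : wt r α m g = ε ^ dotProduct α m := by
  change ∏ i, (g : Fin 3 → ℂˣ) i ^ m i = _
  simp only [hg, ← zpow_mul, dotProduct, Fin.sum_univ_three, Fin.prod_univ_three, zpow_add]

theorem exists_units_isPrimitiveRoot {r : ℕ} (hr : 0 < r) : ∃ ζ : ℂˣ, IsPrimitiveRoot ζ r :=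
  ⟨_, (Complex.isPrimitiveRoot_exp r hr.ne').isUnit_unit hr.ne'⟩

theorem eq_pow_of_units_pow_eq_one {r : ℕ} (hr : 0 < r) {ζ ε : ℂˣ} (hζ : IsPrimitiveRoot ζ r)
    (hε : ε ^ r = 1) : ∃ k : ℕ, ε = ζ ^ k := by
  have : NeZero r := ⟨hr.ne'⟩
  have hζ' : IsPrimitiveRoot (ζ : ℂ) r := IsPrimitiveRoot.coe_units_iff.2 hζ
  obtain ⟨k, _, hk⟩ := hζ'.eq_pow_of_pow_eq_one (ξ := (ε : ℂ)) (by
    rw [← Units.val_pow_eq_pow_val, hε, Units.val_one])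
  exact ⟨k, Units.ext (by simpa using hk.symm)⟩

/-- Equality of weights is tested on the element given by a primitive `r`-th root of unity, where it
says that `r` divides `α · (m - m')`. -/
theorem wt_eq_iff {r : ℕ} (hr : 0 < r) (α : Fin 3 → ℤ) (m m' : LMono) :
    wt r α m = wt r α m' ↔ m - m' ∈ latticeM r α := by
  rw [mem_latticeM hr, dotProduct_sub]
  constructor
  · intro h
    obtain ⟨ζ, hζ⟩ := exists_units_isPrimitiveRoot hr
    have h1 := DFunLike.congr_fun h ⟨fun i => ζ ^ α i, ζ, hζ.pow_eq_one, fun i => rfl⟩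
    rw [wt_apply_of_eq m _ fun i => rfl, wt_apply_of_eq m' _ fun i => rfl] at h1
    rw [← hζ.zpow_eq_one_iff_dvd, zpow_sub, h1, mul_inv_cancel]
  · rintro ⟨k, hk⟩
    ext1 g
    obtain ⟨ε, hε, hg⟩ := g.2
    rw [wt_apply_of_eq m g hg, wt_apply_of_eq m' g hg, eq_add_of_sub_eq hk, zpow_add, zpow_mul,
      zpow_natCast, hε, one_zpow, one_mul]

/-- The group is generated by the element `g₀` of a primitive root `ζ`, so a character is fixed by
its value `ζ ^ k` there. As `α 0 = 1`, the power `x ^ k` has that weight. -/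
theorem wt_surjective {r : ℕ} (hr : 0 < r) {α : Fin 3 → ℤ} (hα : α 0 = 1) :
    Function.Surjective (wt r α) := by
  intro χ
  obtain ⟨ζ, hζ⟩ := exists_units_isPrimitiveRoot hr
  let g₀ : groupOfType r α := ⟨fun i => ζ ^ α i, ζ, hζ.pow_eq_one, fun i => rfl⟩
  have hg₀ : g₀ ^ r = 1 := by
    ext1
    funext i
    change (ζ ^ α i) ^ r = 1
    rw [← zpow_natCast, zpow_comm, zpow_natCast, hζ.pow_eq_one, one_zpow]
  obtain ⟨k, hk⟩ := eq_pow_of_units_pow_eq_one hr hζ (ε := χ g₀) (by rw [← map_pow, hg₀, map_one])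
  refine ⟨Pi.single 0 (k : ℤ), ?_⟩
  ext1 g
  obtain ⟨ε, hε, hg⟩ := g.2
  obtain ⟨j, rfl⟩ := eq_pow_of_units_pow_eq_one hr hζ hε
  have hgj : g = g₀ ^ j := by
    ext1
    funext i
    change (g : Fin 3 → ℂˣ) i = (ζ ^ α i) ^ j
    rw [hg, ← zpow_natCast, ← zpow_natCast, zpow_comm]
  rw [wt_apply_of_eq _ g hg, hgj, map_pow, hk, dotProduct_single, hα, one_mul, zpow_natCast,
    ← pow_mul, ← pow_mul, mul_comm]

/-! ## Abstract round down functions -/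

/-- A round down function `φ` from the monomials for the lattice `M` to those for `M'`. -/
structure IsRoundDown (M M' : AddSubgroup LMono) (φ : LMono → LMono) : Prop where
  mono : Monotone φ
  map_add : ∀ m, ∀ k ∈ M, φ (m + k) = φ m + φ k
  map_mem : ∀ k ∈ M, φ k ∈ M'
  eq_zero : ∀ k ∈ M, φ k = 0 → k = 0
  exists_mem : ∀ k' ∈ M', ∃ k ∈ M, φ k = k'
  lift : ∀ (g : LMono) (i : Fin 3), ∃ m, φ m = g ∧ φ (m + Pi.single i 1) = g + Pi.single i 1
  fiber : ∀ m m', φ m = φ m' → Relation.ReflTransGen (Step (φ ⁻¹' {φ m})) m m'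

theorem Step.mono {Γ Γ' : Set LMono} (h : Γ ⊆ Γ') {p q : LMono} (hs : Step Γ p q) : Step Γ' p q :=
  ⟨h hs.1, h hs.2.1, hs.2.2⟩

theorem Step.symm {Γ : Set LMono} {p q : LMono} (hs : Step Γ p q) : Step Γ q p := by
  obtain ⟨hp, hq, i, h | h⟩ := hs
  · exact ⟨hq, hp, i, Or.inr (by rw [h, add_sub_cancel_right])⟩
  · exact ⟨hq, hp, i, Or.inl (by rw [h, sub_add_cancel])⟩

namespace IsRoundDown

variable {M M' : AddSubgroup LMono} {φ : LMono → LMono}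

theorem map_zero (h : IsRoundDown M M' φ) : φ 0 = 0 := by
  simpa using h.map_add 0 0 M.zero_mem

theorem map_sub (h : IsRoundDown M M' φ) {m m' : LMono} (hm : m - m' ∈ M) :
    φ (m - m') = φ m - φ m' := by
  rw [eq_sub_iff_add_eq', ← h.map_add _ _ hm, add_sub_cancel]

/-- The isomorphism of lattices given by a round down function. -/
def equiv (h : IsRoundDown M M' φ) : M ≃+ M' :=
  AddEquiv.ofBijective
    ({ toFun := fun k => ⟨φ k, h.map_mem k k.2⟩
       map_zero' := Subtype.ext h.map_zero
       map_add' := fun k l => Subtype.ext (h.map_add k l l.2) } : M →+ M') <| by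
    constructor
    · rw [injective_iff_map_eq_zero]
      intro k hk
      exact Subtype.ext (h.eq_zero k k.2 (congrArg Subtype.val hk))
    · rintro ⟨k', hk'⟩
      obtain ⟨k, hk, rfl⟩ := h.exists_mem k' hk'
      exact ⟨⟨k, hk⟩, rfl⟩

theorem coe_equiv (h : IsRoundDown M M' φ) (k : M) : (h.equiv k : LMono) = φ k := rfl

/-- A path downstairs is lifted step by step: `lift` provides one pair of neighbours over each step,
and connectedness of the fibres joins the end of one lifted step to the start of the next. -/
theorem connected_preimage (h : IsRoundDown M M' φ) {Γ' : Set LMono} {g : LMono}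
    (hg : Relation.ReflTransGen (Step Γ') g 0) (hgΓ : g ∈ Γ') (m : LMono) (hm : φ m = g) :
    Relation.ReflTransGen (Step (φ ⁻¹' Γ')) m 0 := by
  have key : ∀ m m', φ m ∈ Γ' → φ m = φ m' →
      Relation.ReflTransGen (Step (φ ⁻¹' Γ')) m m' := fun m m' hmΓ hmm' =>
    Relation.ReflTransGen.mono (fun p q => Step.mono
      (Set.preimage_mono (Set.singleton_subset_iff.2 hmΓ))) _ _ (h.fiber m m' hmm')
  induction hg using Relation.ReflTransGen.head_induction_on generalizing m with
  | refl => exact key m 0 (hm ▸ hgΓ) (by rw [hm, h.map_zero])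
  | @head g g' hs _ ih =>
    have : ∃ m₁ m₂, φ m₁ = g ∧ φ m₂ = g' ∧
        ∃ i : Fin 3, m₂ = m₁ + Pi.single i 1 ∨ m₂ = m₁ - Pi.single i 1 := by
      obtain ⟨_, _, i, rfl | rfl⟩ := hs
      · obtain ⟨m₁, h₁, h₂⟩ := h.lift g i
        exact ⟨m₁, _, h₁, h₂, i, Or.inl rfl⟩
      · obtain ⟨m₁, h₁, h₂⟩ := h.lift (g - Pi.single i 1) i
        exact ⟨m₁ + Pi.single i 1, m₁, by rw [h₂, sub_add_cancel], h₁, i,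
          Or.inr (by rw [add_sub_cancel_right])⟩
    obtain ⟨m₁, m₂, h₁, h₂, hi⟩ := this
    refine (key m m₁ (hm ▸ hgΓ) (hm.trans h₁.symm)).trans (.head ⟨?_, ?_, hi⟩ (ih hs.2.1 m₂ h₂))
    · rw [Set.mem_preimage, h₁]; exact hs.1
    · rw [Set.mem_preimage, h₂]; exact hs.2.1

variable {r r' : ℕ} {α α' : Fin 3 → ℤ}

theorem isGPrebrick_preimage (h : IsRoundDown (latticeM r α) (latticeM r' α') φ) (hr : 0 < r)
    (hr' : 0 < r') (hα : α 0 = 1) {Γ' : Set LMono} (hΓ : IsGPrebrick r' α' Γ') :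
    IsGPrebrick r α (φ ⁻¹' Γ') where
  one_mem := by rw [Set.mem_preimage, h.map_zero]; exact hΓ.one_mem
  weights := by
    refine ⟨fun _ _ => Set.mem_univ _, fun m hm m' hm' hw => ?_, fun χ _ => ?_⟩
    · rw [wt_eq_iff hr] at hw
      -- The images have equal weight and both lie in `Γ'`, so they coincide; injectivity of `φ` on
      -- `M` then gives `m = m'`.
      have h1 := hΓ.weights.injOn hm hm' <| (wt_eq_iff hr' _ _ _).2 <|
        h.map_sub hw ▸ h.map_mem _ hw
      exact sub_eq_zero.1 (h.eq_zero _ hw (by rw [h.map_sub hw, h1, sub_self]))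
    · obtain ⟨m, rfl⟩ := wt_surjective hr hα χ
      obtain ⟨g, hg, hgw⟩ := hΓ.weights.surjOn (Set.mem_univ (wt r' α' (φ m)))
      -- Correcting `m` by an element of `M` keeps its weight and moves its image to the
      -- representative `g` in `Γ'`.
      obtain ⟨k, hk, hφk⟩ := h.exists_mem _ ((wt_eq_iff hr' _ _ _).1 hgw)
      refine ⟨m + k, ?_, (wt_eq_iff hr _ _ _).2 (by rwa [add_sub_cancel_left])⟩
      rw [Set.mem_preimage, h.map_add _ _ hk, hφk, add_sub_cancel]
      exact hg
  convex := by
    intro m hm n n' hn hn' hmem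
    have h1 : φ m ≤ φ (n + m) := h.mono (le_add_of_nonneg_left hn)
    have h2 : φ (n + m) ≤ φ (n' + n + m) := h.mono (by
      rw [add_assoc]; exact le_add_of_nonneg_left hn')
    -- Monotonicity makes the increments of `φ` genuine monomials, which play the roles of `n` and
    -- `n'` downstairs.
    have := hΓ.convex _ hm (φ (n + m) - φ m) (φ (n' + n + m) - φ (n + m)) (sub_nonneg.2 h1)
      (sub_nonneg.2 h2) (by
        rw [sub_add_sub_cancel, sub_add_cancel]; exact hmem)
    rwa [sub_add_cancel] at this
  connected := fun m hm => h.connected_preimage (hΓ.connected _ hm) hm m rfl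

/-- It is enough to multiply by one variable at a time: if `w` represents `x_i m`, then `n m / m'`
is the product of `x_i m / w` and `(n / x_i) w / m'`. The induction is on the degree of `n`. -/
theorem _root_.EconBrick.IsGPrebrick.semigroupS_le (hr : 0 < r) {Γ : Set LMono}
    (hΓ : IsGPrebrick r α Γ) {N : AddSubmonoid (latticeM r α)}
    (hN : ∀ i : Fin 3, ∀ m ∈ Γ, ∀ m' ∈ Γ, ∀ d : latticeM r α,
      (d : LMono) = Pi.single i 1 + m - m' → d ∈ N) : semigroupS r α Γ ≤ N := by
  refine AddSubmonoid.closure_le.2 ?_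
  rintro d ⟨n, hn, m, hm, m', hm', -, hd⟩
  obtain ⟨t, ht⟩ : ∃ t : ℕ, ∑ i, (n i).toNat = t := ⟨_, rfl⟩
  induction t generalizing n m d with
  | zero =>
    have hn0 : n = 0 := by
      funext i
      have h1 : (n i).toNat = 0 := (Finset.sum_eq_zero_iff.1 ht) i (Finset.mem_univ i)
      have h2 : 0 ≤ n i := hn i
      change n i = 0
      omega
    rw [hn0, zero_add] at hd
    have hmm : m = m' := hΓ.weights.injOn hm hm' ((wt_eq_iff hr _ _ _).2 (hd ▸ d.2))
    have : d = 0 := Subtype.ext (by rw [hd, hmm, sub_self]; rfl)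
    rw [this]
    exact N.zero_mem
  | succ t ih =>
    obtain ⟨i, hi⟩ : ∃ i, 0 < n i := by
      by_contra! hcon
      have : ∑ i, (n i).toNat = 0 := Finset.sum_eq_zero fun i _ => Int.toNat_of_nonpos (hcon i)
      omega
    obtain ⟨w, hw, hww⟩ := hΓ.weights.surjOn (Set.mem_univ (wt r α (Pi.single i 1 + m)))
    have hwm := (wt_eq_iff hr _ _ _).1 hww.symm
    have hsum : ∑ l, (n l).toNat = ∑ l, ((n - Pi.single i 1 : LMono) l).toNat + 1 := by
      have : ∀ l, (n l).toNat = ((n - Pi.single i 1 : LMono) l).toNat + if l = i then 1 else 0 := by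
        intro l
        have h2 : 0 ≤ n l := hn l
        by_cases hl : l = i
        · subst hl; simp; omega
        · simp [hl]
      simp_rw [this, Finset.sum_add_distrib]
      simp
    have hd' : ((d - ⟨_, hwm⟩ : latticeM r α) : LMono) = (n - Pi.single i 1) + w - m' := by
      rw [AddSubgroup.coe_sub, hd]
      change n + m - m' - (Pi.single i 1 + m - w) = _
      abel
    have h1 := ih (d := d - ⟨_, hwm⟩) (n - Pi.single i 1) (fun l => by
      change 0 ≤ (n - Pi.single i 1 : LMono) l
      have h2 : 0 ≤ n l := hn l
      by_cases hl : l = i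
      · subst hl; simp; omega
      · simpa [hl] using h2) w hw hd' (by omega)
    have h2 := hN i m hm w hw ⟨_, hwm⟩ rfl
    have := N.add_mem h1 h2
    rwa [sub_add_cancel] at this

theorem _root_.EconBrick.mem_semigroupS_of_eq (hr : 0 < r) {Γ : Set LMono} {n m m' : LMono}
    (hn : 0 ≤ n) (hm : m ∈ Γ) (hm' : m' ∈ Γ) {d : latticeM r α} (hd : (d : LMono) = n + m - m') :
    d ∈ semigroupS r α Γ :=
  AddSubmonoid.subset_closure
    ⟨n, hn, m, hm, m', hm', ((wt_eq_iff hr _ _ _).2 (hd ▸ d.2)).symm, hd⟩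

/-- A generator `n m / m'` goes to a generator with multiplier `φ(n m) / φ(m)`, genuine by
monotonicity. -/
theorem semigroupS_preimage_le (h : IsRoundDown (latticeM r α) (latticeM r' α') φ)
    (hr' : 0 < r') (Γ' : Set LMono) {d : latticeM r α} {d' : latticeM r' α'}
    (hd : d ∈ semigroupS r α (φ ⁻¹' Γ')) (hdd : h.equiv d = d') : d' ∈ semigroupS r' α' Γ' := by
  subst hdd
  unfold semigroupS at hd
  induction hd using AddSubmonoid.closure_induction with
  | mem d hd =>
    obtain ⟨n, hn, m, hm, m', hm', -, hd⟩ := hd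
    refine mem_semigroupS_of_eq hr' (n := φ (n + m) - φ m) (m := φ m) (m' := φ m')
      (sub_nonneg.2 (h.mono (le_add_of_nonneg_left hn))) hm hm' ?_
    rw [sub_add_cancel, h.coe_equiv, hd, h.map_sub (hd ▸ d.2)]
  | zero => rw [_root_.map_zero]; exact zero_mem _
  | add x y _ _ hx hy => rw [_root_.map_add]; exact add_mem hx hy

/-- By `semigroupS_le` only multiplication by a single variable downstairs needs lifting, and this
is what the field `lift` supplies. -/
theorem le_semigroupS_preimage (h : IsRoundDown (latticeM r α) (latticeM r' α') φ) (hr : 0 < r)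
    (hr' : 0 < r') {Γ' : Set LMono} (hΓ : IsGPrebrick r' α' Γ') :
    semigroupS r' α' Γ' ≤ (semigroupS r α (φ ⁻¹' Γ')).map h.equiv.toAddMonoidHom := by
  refine hΓ.semigroupS_le hr' fun i g hg g' hg' d hd => ?_
  obtain ⟨m, hm, hmi⟩ := h.lift g i
  obtain ⟨k, hk, hφk⟩ := h.exists_mem d d.2
  have hneg : φ (-k) = -φ k := by
    have := h.map_add k (-k) (neg_mem hk)
    rw [add_neg_cancel, h.map_zero] at this
    exact (neg_eq_of_add_eq_zero_right this.symm).symm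
  have hm' : φ (m + Pi.single i 1 - k) = g' := by
    rw [sub_eq_add_neg, h.map_add _ _ (neg_mem hk), hmi, hneg, hφk, hd]
    abel
  refine ⟨⟨k, hk⟩, ?_, Subtype.ext hφk⟩
  refine mem_semigroupS_of_eq hr (n := Pi.single i 1) (m := m) (m' := m + Pi.single i 1 - k)
    (by rw [Pi.single_nonneg]; exact zero_le_one) (by rw [Set.mem_preimage, hm]; exact hg)
    (by rw [Set.mem_preimage, hm']; exact hg') ?_
  rw [add_comm, sub_sub_cancel]

theorem mem_semigroupS_preimage_iff (h : IsRoundDown (latticeM r α) (latticeM r' α') φ)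
    (hr : 0 < r) (hr' : 0 < r') {Γ' : Set LMono} (hΓ : IsGPrebrick r' α' Γ') (d : latticeM r α) :
    d ∈ semigroupS r α (φ ⁻¹' Γ') ↔ h.equiv d ∈ semigroupS r' α' Γ' := by
  refine ⟨fun hd => h.semigroupS_preimage_le hr' Γ' hd rfl, fun hd => ?_⟩
  obtain ⟨d', hd', he⟩ := h.le_semigroupS_preimage hr hr' hΓ hd
  rwa [← h.equiv.injective he]

end IsRoundDown

/-! ## The coordinate round down functions -/

/-- The round down function replacing the `j`-th exponent by `⌊α · m / r⌋`. -/
def roundDown (r : ℕ) (α : Fin 3 → ℤ) (j : Fin 3) (m : LMono) : LMono :=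
  Function.update m j (dotProduct α m / r)

theorem dotProduct_update_right (α m : Fin 3 → ℤ) (j : Fin 3) (x : ℤ) :
    dotProduct α (Function.update m j x) = dotProduct α m - α j * m j + α j * x := by
  have : Function.update m j x = m + Pi.single j (x - m j) := by
    funext i
    by_cases hi : i = j
    · subst hi; simp
    · simp [hi]
  rw [this, dotProduct_add, dotProduct_single]
  ring

theorem dotProduct_add_single (α m : Fin 3 → ℤ) (j : Fin 3) :
    dotProduct α (m + Pi.single j 1) = dotProduct α m + α j := by
  rw [dotProduct_add, dotProduct_single, mul_one]

theorem ediv_eq_of_bounds {x r q : ℤ} (h1 : r * q ≤ x) (h2 : x < r * q + r) : x / r = q :=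
  Int.ediv_eq_iff_of_pos (by linarith) |>.2 ⟨by linarith, by linarith⟩

theorem roundDown_monotone {r : ℕ} (hr : 0 < r) {α : Fin 3 → ℤ} (hα : ∀ i, 0 ≤ α i) (j : Fin 3) :
    Monotone (roundDown r α j) := by
  intro m m' hm i
  by_cases hi : i = j
  · subst hi
    simp only [roundDown, Function.update_self]
    exact Int.ediv_le_ediv (by exact_mod_cast hr)
      (Finset.sum_le_sum fun l _ => mul_le_mul_of_nonneg_left (hm l) (hα l))
  · simpa [roundDown, hi] using hm i

/-- Two points of a fibre differ only in the `j`-th exponent, and by monotonicity the whole segment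
between them stays in the fibre. -/
theorem roundDown_fiber {r : ℕ} (hr : 0 < r) {α : Fin 3 → ℤ} (hα : ∀ i, 0 ≤ α i) (j : Fin 3)
    (m m' : LMono) (h : roundDown r α j m = roundDown r α j m') :
    Relation.ReflTransGen (Step (roundDown r α j ⁻¹' {roundDown r α j m})) m m' := by
  have hmono := roundDown_monotone hr hα j
  have up : ∀ (n : ℕ) (m : LMono),
      roundDown r α j (m + Pi.single j (n : ℤ)) = roundDown r α j m →
      Relation.ReflTransGen (Step (roundDown r α j ⁻¹' {roundDown r α j m})) m
        (m + Pi.single j (n : ℤ)) := by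
    intro n
    induction n with
    | zero => intro m _; simpa using Relation.ReflTransGen.refl
    | succ n ih =>
      intro m hm
      have hs : m + Pi.single j ((n + 1 : ℕ) : ℤ) = m + Pi.single j (n : ℤ) + Pi.single j 1 := by
        rw [add_assoc, ← Pi.single_add, Nat.cast_succ]
      have h1 : m ≤ m + Pi.single j (n : ℤ) :=
        le_add_of_nonneg_right (by rw [Pi.single_nonneg]; positivity)
      have h2 : m + Pi.single j (n : ℤ) ≤ m + Pi.single j ((n + 1 : ℕ) : ℤ) := by
        rw [hs]; exact le_add_of_nonneg_right (by rw [Pi.single_nonneg]; exact zero_le_one)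
      have h3 : roundDown r α j (m + Pi.single j (n : ℤ)) = roundDown r α j m :=
        le_antisymm (hm ▸ hmono h2) (hmono h1)
      exact (ih m h3).tail ⟨h3, hm, j, Or.inl hs⟩
  have hne : ∀ i, i ≠ j → m i = m' i := fun i hi => by
    simpa [roundDown, hi] using congrFun h i
  rcases le_total (m j) (m' j) with hle | hle
  · have : m' = m + Pi.single j (((m' j - m j).toNat : ℕ) : ℤ) := by
      funext i
      by_cases hi : i = j
      · subst hi; simp; omega
      · simp [hi, hne i hi]
    rw [this] at h ⊢
    exact up _ _ h.symm
  · have : m = m' + Pi.single j (((m j - m' j).toNat : ℕ) : ℤ) := by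
      funext i
      by_cases hi : i = j
      · subst hi; simp; omega
      · simp [hi, hne i hi]
    have h1 := up _ m' (this ▸ h)
    rw [← this, ← h] at h1
    have : Std.Symm (Step (roundDown r α j ⁻¹' {roundDown r α j m})) := ⟨fun _ _ => Step.symm⟩
    exact Std.Symm.symm _ _ h1

/-- Changing the `j`-th exponent moves `α · m` in steps of `α j`, so some value falls in any
half-open window of that length. Taking the window at the bottom of the fibre leaves room to
multiply by another variable. -/
theorem roundDown_exists_low {r : ℕ} {α : Fin 3 → ℤ} {j : Fin 3} (hj : 0 < α j) (g : LMono) :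
    ∃ t : ℤ, r * g j ≤ dotProduct α (Function.update g j t) ∧
      dotProduct α (Function.update g j t) < r * g j + α j := by
  set c := dotProduct α g - α j * g j - r * g j with hc
  refine ⟨-(c / α j), ?_⟩
  rw [dotProduct_update_right]
  have h1 := Int.emod_nonneg c hj.ne'
  have h2 := Int.emod_lt_of_pos c hj
  have h3 := Int.emod_add_mul_ediv c (α j)
  constructor <;> linarith

/-- The condition `hM'` says that the `j`-th exponent of the preimage in `M`, found by solving `α ·
k = r g_j`, is an integer. The bound `α i + α j ≤ r` is what lets a lowest point of a fibre be
multiplied by `x_i` without leaving the window of length `r`. -/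
theorem isRoundDown_roundDown {r : ℕ} (hr : 0 < r) {α : Fin 3 → ℤ} (hα : ∀ i, 0 ≤ α i)
    {j : Fin 3} (hj : 0 < α j) (hij : ∀ i, i ≠ j → α i + α j ≤ r) {M' : AddSubgroup LMono}
    (hM' : ∀ g : LMono, g ∈ M' ↔ α j ∣ r * g j - (dotProduct α g - α j * g j)) :
    IsRoundDown (latticeM r α) M' (roundDown r α j) where
  mono := roundDown_monotone hr hα j
  map_add m k hk := by
    rw [mem_latticeM hr] at hk
    funext i
    by_cases hi : i = j
    · subst hi
      simp only [roundDown, Function.update_self, Pi.add_apply, dotProduct_add]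
      exact Int.add_ediv_of_dvd_right hk
    · simp [roundDown, hi]
  map_mem k hk := by
    rw [mem_latticeM hr] at hk
    rw [hM']
    refine ⟨k j, ?_⟩
    simp only [roundDown, dotProduct_update_right, Function.update_self, Int.mul_ediv_cancel' hk]
    ring
  eq_zero k hk h0 := by
    rw [mem_latticeM hr] at hk
    have h1 : dotProduct α k = 0 := by
      have := congrFun h0 j
      simp only [roundDown, Function.update_self, Pi.zero_apply] at this
      rw [← Int.mul_ediv_cancel' hk, this, mul_zero]
    have h2 : ∀ i, i ≠ j → k i = 0 := fun i hi => by simpa [roundDown, hi] using congrFun h0 i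
    have h3 : k = Pi.single j (k j) := by
      funext i
      by_cases hi : i = j
      · subst hi; simp
      · simp [hi, h2 i hi]
    rw [h3, dotProduct_single] at h1
    rw [h3, (mul_eq_zero.1 h1).resolve_left hj.ne', Pi.single_zero]
  exists_mem k' hk' := by
    obtain ⟨t, ht⟩ := (hM' k').1 hk'
    have h1 : dotProduct α (Function.update k' j t) = r * k' j := by
      rw [dotProduct_update_right]; linarith
    refine ⟨Function.update k' j t, (mem_latticeM hr _ _).2 ⟨_, h1⟩, ?_⟩
    rw [roundDown, h1, Int.mul_ediv_cancel_left _ (by exact_mod_cast hr.ne'),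
      Function.update_idem, Function.update_eq_self]
  lift g i := by
    have hjr : α j ≤ r := by
      obtain ⟨i, hi⟩ := exists_ne j
      linarith [hij i hi, hα i]
    have fiber : ∀ (g : LMono) (t : ℤ), r * g j ≤ dotProduct α (Function.update g j t) →
        dotProduct α (Function.update g j t) < r * g j + r →
        roundDown r α j (Function.update g j t) = g := fun g t h1 h2 => by
      rw [roundDown, ediv_eq_of_bounds h1 h2, Function.update_idem, Function.update_eq_self]
    by_cases hi : i = j
    · subst hi
      -- For the `j`-th variable, start from the lowest point over the target; one step below it
      -- lies over `g`, because `α j ≤ r`.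
      obtain ⟨t, h1, h2⟩ := roundDown_exists_low (r := r) hj (g + Pi.single i 1)
      have e1 : Function.update (g + Pi.single i 1) i t = Function.update g i (t - 1) + Pi.single i 1 := by
        funext l
        by_cases hl : l = i
        · subst hl; simp
        · simp [hl]
      refine ⟨Function.update g i (t - 1), fiber g _ ?_ ?_, ?_⟩
      · rw [e1, dotProduct_add_single] at h1
        simp only [Pi.add_apply, Pi.single_eq_same] at h1
        linarith
      · rw [e1, dotProduct_add_single] at h2
        simp only [Pi.add_apply, Pi.single_eq_same] at h2
        linarith
      · rw [← e1]
        exact fiber _ _ h1 (by linarith)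
    · obtain ⟨t, h1, h2⟩ := roundDown_exists_low (r := r) hj g
      refine ⟨Function.update g j t, fiber g t h1 (by linarith), ?_⟩
      have e1 : Function.update g j t + Pi.single i 1 = Function.update (g + Pi.single i 1) j t := by
        funext l
        by_cases hl : l = j
        · subst hl; simp [Ne.symm hi]
        · simp [hl]
      have e2 : (g + Pi.single i 1 : LMono) j = g j := by simp [Ne.symm hi]
      rw [e1]
      refine fiber _ _ ?_ ?_
      · rw [← e1, dotProduct_add_single, e2]
        linarith [hα i]
      · rw [← e1, dotProduct_add_single, e2]
        linarith [hij i hi]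
  fiber := roundDown_fiber hr hα j

/-! ## Faces of the orthant and subdivision maps -/

/-- The face of the positive orthant spanned by the basis vectors with index in `I`. -/
def stdCone (I : Set (Fin 3)) : PointedCone ℝ LR :=
  PointedCone.hull ℝ ((fun i => (Pi.single i 1 : LR)) '' I)

theorem mem_stdCone {I : Set (Fin 3)} {u : LR} :
    u ∈ stdCone I ↔ ∀ i, 0 ≤ u i ∧ (i ∉ I → u i = 0) := by
  constructor
  · intro h
    unfold stdCone at h
    induction h using Submodule.span_induction with
    | mem x hx =>
      obtain ⟨j, hj, rfl⟩ := hx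
      intro i
      by_cases hi : i = j
      · subst hi; simp [hj]
      · simp [hi]
    | zero => simp
    | add x y _ _ hx hy =>
      exact fun i => ⟨add_nonneg (hx i).1 (hy i).1, fun hi => by
        simp [(hx i).2 hi, (hy i).2 hi]⟩
    | smul c x _ hx =>
      exact fun i => ⟨mul_nonneg c.2 (hx i).1, fun hi => by simp [(hx i).2 hi]⟩
  · intro h
    rw [show u = ∑ i, u i • (Pi.single i 1 : LR) from (pi_eq_sum_univ' u).trans
      (Finset.sum_congr rfl fun i _ => by congr 1)]
    refine Submodule.sum_mem _ fun i _ => ?_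
    by_cases hi : i ∈ I
    · exact PointedCone.smul_mem _ (h i).1 (Submodule.subset_span ⟨i, hi, rfl⟩)
    · rw [(h i).2 hi, zero_smul]; exact zero_mem _

theorem mem_stdCone_univ {u : LR} : u ∈ stdCone Set.univ ↔ 0 ≤ u := by
  simp [mem_stdCone, Pi.le_def]

/-- The linear map replacing the basis vector `e_j` by the point `α / r`. -/
def subdivMap (r : ℕ) (α : Fin 3 → ℤ) (j : Fin 3) : LR →ₗ[ℝ] LR where
  toFun u i := (if i = j then 0 else u i) + u j * ((α i : ℝ) / r)
  map_add' u v := by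
    funext i
    by_cases hi : i = j <;> simp [hi] <;> ring
  map_smul' c u := by
    funext i
    by_cases hi : i = j <;> simp [hi] <;> ring

theorem subdivMap_apply (r : ℕ) (α : Fin 3 → ℤ) (j : Fin 3) (u : LR) (i : Fin 3) :
    subdivMap r α j u i = (if i = j then 0 else u i) + u j * ((α i : ℝ) / r) := rfl

theorem subdivMap_single_self (r : ℕ) (α : Fin 3 → ℤ) (j : Fin 3) :
    subdivMap r α j (Pi.single j 1) = fun i => (α i : ℝ) / r := by
  funext i
  by_cases hi : i = j <;> simp [subdivMap_apply, hi]

theorem subdivMap_single_of_ne (r : ℕ) (α : Fin 3 → ℤ) {i j : Fin 3} (h : i ≠ j) :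
    subdivMap r α j (Pi.single i 1) = Pi.single i 1 := by
  funext l
  by_cases hl : l = j
  · subst hl; simp [subdivMap_apply, h.symm]
  · simp [subdivMap_apply, hl, h.symm]

theorem subdivMap_injective {r : ℕ} (hr : 0 < r) {α : Fin 3 → ℤ} {j : Fin 3} (hj : 0 < α j) :
    Function.Injective (subdivMap r α j) := by
  rw [injective_iff_map_eq_zero]
  intro u hu
  have hr' : (0 : ℝ) < r := by exact_mod_cast hr
  have hj' : (0 : ℝ) < α j := by exact_mod_cast hj
  have h1 : u j = 0 := by
    have := congrFun hu j
    rw [subdivMap_apply, if_pos rfl, zero_add] at this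
    exact (mul_eq_zero.1 this).resolve_right (by positivity)
  funext i
  by_cases hi : i = j
  · subst hi; exact h1
  · have := congrFun hu i
    rwa [subdivMap_apply, if_neg hi, h1, zero_mul, add_zero] at this

theorem subdivMap_surjective {r : ℕ} (hr : 0 < r) {α : Fin 3 → ℤ} {j : Fin 3} (hj : 0 < α j) :
    Function.Surjective (subdivMap r α j) :=
  LinearMap.injective_iff_surjective.1 (subdivMap_injective hr hj)

theorem subdivMap_nonneg (r : ℕ) {α : Fin 3 → ℤ} (hα : ∀ i, 0 ≤ α i) (j : Fin 3) {u : LR}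
    (hu : 0 ≤ u) : 0 ≤ subdivMap r α j u := by
  intro i
  have h1 : (0 : ℝ) ≤ α i := by exact_mod_cast hα i
  have h2 := hu j
  have h3 := hu i
  simp only [Pi.zero_apply] at h2 h3
  rw [subdivMap_apply]
  split_ifs <;> simp only [Pi.zero_apply] <;> positivity

/-- For `m ∈ M` the floor is exact, so `roundDown` is linear there and is the transpose of
`subdivMap`: pairing `m` with `α / r`, the image of `e_j`, gives the new `j`-th exponent. -/
theorem pairing_subdivMap {r : ℕ} (hr : 0 < r) (α : Fin 3 → ℤ) (j : Fin 3) (u : LR)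
    {m : LMono} (hm : m ∈ latticeM r α) :
    pairing (subdivMap r α j u) m = pairing u (roundDown r α j m) := by
  obtain ⟨k, hk⟩ := (mem_latticeM hr α m).1 hm
  have hr' : (r : ℝ) ≠ 0 := by positivity
  have hφ : roundDown r α j m = Function.update m j k := by
    rw [roundDown, hk, Int.mul_ediv_cancel_left _ (by exact_mod_cast hr.ne')]
  have h1 : ∑ i, u j * ((α i : ℝ) / r) * (m i : ℝ) = u j * k := by
    have : ∑ i, (α i : ℝ) * m i = r * k := by exact_mod_cast hk
    calc _ = u j / r * ∑ i, (α i : ℝ) * m i := by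
          rw [Finset.mul_sum]; exact Finset.sum_congr rfl fun i _ => by ring
      _ = u j * k := by rw [this]; field_simp
  rw [hφ]
  simp only [pairing, subdivMap_apply, add_mul, Finset.sum_add_distrib, h1]
  rw [← Finset.sum_erase_add _ _ (Finset.mem_univ j),
    ← Finset.sum_erase_add _ (fun i => u i * ((Function.update m j k i : ℤ) : ℝ))
      (Finset.mem_univ j), if_pos rfl, zero_mul, add_zero, Function.update_self]
  congr 1
  refine Finset.sum_congr rfl fun i hi => ?_
  rw [if_neg (Finset.ne_of_mem_erase hi), Function.update_of_ne (Finset.ne_of_mem_erase hi)]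

/-! ## Pairs of a smooth cone and a prebrick -/

/-- A full-dimensional smooth cone `σ` in the orthant and a prebrick `Γ` with
`S(Γ) = σ^∨ ∩ M`. -/
structure IsBrickPair (r : ℕ) (α : Fin 3 → ℤ) (σ : PointedCone ℝ LR) (Γ : Set LMono) : Prop where
  prebrick : IsGPrebrick r α Γ
  semigroup_eq : semigroupS r α Γ = dualSemigroup (latticeM r α) σ
  free : Nonempty (dualSemigroup (latticeM r α) σ ≃+ (Fin 3 →₀ ℕ))
  mem_of_dual : ∀ u : LR, (∀ m ∈ dualSemigroup (latticeM r α) σ, 0 ≤ pairing u m) → u ∈ σ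
  full : ∀ l : LR →ₗ[ℝ] ℝ, (∀ u ∈ σ, l u = 0) → l = 0
  le : σ ≤ stdCone Set.univ

theorem pairing_single_right (u : LR) (i : Fin 3) : pairing u (Pi.single i 1) = u i := by
  simp [pairing, Pi.single_apply]

theorem pairing_single_left (m : LMono) (i : Fin 3) :
    pairing (Pi.single i 1 : LR) m = m i := by
  simp [pairing, Pi.single_apply]

theorem mem_latticeM_one (α : Fin 3 → ℤ) (m : LMono) : m ∈ latticeM 1 α :=
  (mem_latticeM one_pos α m).2 (by simp)

theorem mem_dualSemigroup_stdCone {M : AddSubgroup LMono} {m : M} :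
    m ∈ dualSemigroup M (stdCone Set.univ) ↔ 0 ≤ (m : LMono) := by
  constructor
  · intro h i
    have := h (Pi.single i 1) (Submodule.subset_span ⟨i, trivial, rfl⟩)
    rw [pairing_single_left] at this
    exact_mod_cast this
  · intro h u hu
    rw [mem_stdCone_univ] at hu
    exact Finset.sum_nonneg fun i _ => mul_nonneg (hu i) (by exact_mod_cast h i)

theorem isGPrebrick_one (α : Fin 3 → ℤ) (hα : α 0 = 1) : IsGPrebrick 1 α {0} where
  one_mem := rfl
  weights := by
    refine ⟨fun _ _ => Set.mem_univ _, Set.injOn_singleton _ _, fun χ _ => ⟨0, rfl, ?_⟩⟩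
    obtain ⟨m, rfl⟩ := wt_surjective one_pos hα χ
    exact (wt_eq_iff one_pos _ _ _).2 (mem_latticeM_one _ _)
  convex := by
    rintro m rfl n n' hn hn' h
    have h0 : n' + n = 0 := by simpa using h
    rw [add_zero]
    exact le_antisymm (h0 ▸ le_add_of_nonneg_left hn') hn
  connected := by
    rintro m rfl
    exact .refl

theorem isBrickPair_one (α : Fin 3 → ℤ) (hα : α 0 = 1) :
    IsBrickPair 1 α (stdCone Set.univ) {0} where
  prebrick := isGPrebrick_one α hα
  semigroup_eq := by
    apply le_antisymm
    · refine AddSubmonoid.closure_le.2 ?_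
      rintro d ⟨n, hn, m, rfl, m', rfl, -, hd⟩
      rw [add_zero, sub_zero] at hd
      exact mem_dualSemigroup_stdCone.2 (hd ▸ hn)
    · intro d hd
      exact mem_semigroupS_of_eq one_pos (mem_dualSemigroup_stdCone.1 hd) (Γ := {0}) (m := 0)
        (m' := 0) rfl rfl
        (by rw [add_zero, sub_zero])
  free := by
    let f : (Fin 3 →₀ ℕ) →+ dualSemigroup (latticeM 1 α) (stdCone Set.univ) :=
      { toFun := fun n => ⟨⟨fun i => (n i : ℤ), mem_latticeM_one _ _⟩,
          mem_dualSemigroup_stdCone.2 fun i => Int.natCast_nonneg _⟩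
        map_zero' := by ext i; simp
        map_add' := fun m n => by ext i; simp }
    have hf : ∀ n i, ((f n : latticeM 1 α) : LMono) i = n i := fun n i => rfl
    refine ⟨(AddEquiv.ofBijective f ⟨fun m n h => ?_, fun d => ?_⟩).symm⟩
    · ext i
      have := congrFun (congrArg (fun d : dualSemigroup (latticeM 1 α) (stdCone Set.univ) =>
        ((d : latticeM 1 α) : LMono)) h) i
      simp only [hf] at this
      exact_mod_cast this
    · have hd := mem_dualSemigroup_stdCone.1 d.2
      refine ⟨Finsupp.equivFunOnFinite.symm fun i => (((d : latticeM 1 α) : LMono) i).toNat, ?_⟩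
      ext i
      rw [hf]
      simpa using hd i
  mem_of_dual u h := by
    rw [mem_stdCone_univ]
    intro i
    have := h ⟨Pi.single i 1, mem_latticeM_one _ _⟩
      (mem_dualSemigroup_stdCone.2 (by rw [Pi.single_nonneg]; exact zero_le_one))
    rwa [pairing_single_right] at this
  full l hl := by
    refine LinearMap.pi_ext' fun i => LinearMap.ext_ring ?_
    exact hl _ (Submodule.subset_span ⟨i, trivial, rfl⟩)
  le := le_rfl

theorem mem_dualSemigroup_map_iff {r : ℕ} (hr : 0 < r) {α : Fin 3 → ℤ} {j : Fin 3}
    {M' : AddSubgroup LMono} (h : IsRoundDown (latticeM r α) M' (roundDown r α j))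
    (σ : PointedCone ℝ LR) (d : latticeM r α) :
    d ∈ dualSemigroup (latticeM r α) (σ.map (subdivMap r α j)) ↔
      h.equiv d ∈ dualSemigroup M' σ := by
  constructor
  · intro hd u hu
    rw [h.coe_equiv, ← pairing_subdivMap hr α j u d.2]
    exact hd _ ⟨u, hu, rfl⟩
  · rintro hd _ ⟨u, hu, rfl⟩
    have := hd u hu
    rw [h.coe_equiv, ← pairing_subdivMap hr α j u d.2] at this
    exact this

/-- Everything is transported along the lattice isomorphism `h.equiv` and its transpose `subdivMap`,
which is an invertible linear map of `ℝ³`. -/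
theorem IsBrickPair.subdiv {r r' : ℕ} (hr : 0 < r) (hr' : 0 < r') {α α' : Fin 3 → ℤ}
    (hα : ∀ i, 0 ≤ α i) (hα0 : α 0 = 1) {j : Fin 3} (hj : 0 < α j)
    (h : IsRoundDown (latticeM r α) (latticeM r' α') (roundDown r α j))
    {σ : PointedCone ℝ LR} {Γ : Set LMono} (hp : IsBrickPair r' α' σ Γ) :
    IsBrickPair r α (σ.map (subdivMap r α j)) (roundDown r α j ⁻¹' Γ) where
  prebrick := h.isGPrebrick_preimage hr hr' hα0 hp.prebrick
  semigroup_eq := by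
    ext1 d
    rw [h.mem_semigroupS_preimage_iff hr hr' hp.prebrick, hp.semigroup_eq,
      mem_dualSemigroup_map_iff hr h]
  free := by
    obtain ⟨e⟩ := hp.free
    let f : dualSemigroup (latticeM r α) (σ.map (subdivMap r α j)) →+
        dualSemigroup (latticeM r' α') σ :=
      { toFun := fun d => ⟨h.equiv d, (mem_dualSemigroup_map_iff hr h σ d).1 d.2⟩
        map_zero' := Subtype.ext (map_zero h.equiv)
        map_add' := fun c d => Subtype.ext (map_add h.equiv _ _) }
    refine ⟨(AddEquiv.ofBijective f ⟨fun c d hcd => ?_, fun d => ?_⟩).trans e⟩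
    · exact Subtype.ext (h.equiv.injective (congrArg Subtype.val hcd))
    · obtain ⟨c, hc⟩ := h.equiv.surjective (d : latticeM r' α')
      exact ⟨⟨c, (mem_dualSemigroup_map_iff hr h σ c).2 (hc ▸ d.2)⟩, Subtype.ext hc⟩
  mem_of_dual u hu := by
    obtain ⟨u, rfl⟩ := subdivMap_surjective hr hj u
    refine ⟨u, hp.mem_of_dual u fun m hm => ?_, rfl⟩
    obtain ⟨c, rfl⟩ := h.equiv.surjective m
    rw [h.coe_equiv, ← pairing_subdivMap hr α j u c.2]
    exact hu c ((mem_dualSemigroup_map_iff hr h σ c).2 hm)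
  full l hl := by
    have h0 := hp.full (l.comp (subdivMap r α j)) fun u hu => hl _ ⟨u, hu, rfl⟩
    refine LinearMap.ext fun u => ?_
    obtain ⟨u, rfl⟩ := subdivMap_surjective hr hj u
    exact LinearMap.congr_fun h0 u
  le := by
    rintro _ ⟨u, hu, rfl⟩
    exact mem_stdCone_univ.2 (subdivMap_nonneg r hα j (mem_stdCone_univ.1 (hp.le hu)))

/-! ## Consequences for the toric varieties -/

theorem torusAct_single {M : AddSubgroup LMono} (S : AddSubmonoid M)
    (t : Multiplicative M →* ℂˣ) (s : S) :
    torusAct S t (AddMonoidAlgebra.single s 1) =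
      AddMonoidAlgebra.single s ((t (Multiplicative.ofAdd (s : M)) : ℂˣ) : ℂ) := by
  unfold torusAct
  rw [AddMonoidAlgebra.lift_single, one_smul]
  rfl

open Classical in
/-- The `ℂ`-point of `Spec ℂ[S]` at which all monomials other than `1` vanish. -/
def vertexPoint {S : Type*} [AddCommMonoid S] (hS : ∀ s t : S, s + t = 0 ↔ s = 0 ∧ t = 0) :
    AddMonoidAlgebra ℂ S →ₐ[ℂ] ℂ :=
  AddMonoidAlgebra.lift ℂ ℂ S
    { toFun := fun s => if s.toAdd = 0 then 1 else 0
      map_one' := if_pos rfl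
      map_mul' := fun s t => by
        rw [toAdd_mul, ite_zero_mul_ite_zero, mul_one]
        exact if_congr (hS _ _) rfl rfl }

open Classical in
theorem vertexPoint_single_zero {S : Type*} [AddCommMonoid S]
    (hS : ∀ s t : S, s + t = 0 ↔ s = 0 ∧ t = 0) (c : ℂ) :
    vertexPoint hS (AddMonoidAlgebra.single 0 c) = c := by
  unfold vertexPoint
  rw [AddMonoidAlgebra.lift_single]
  change c • (if (0 : S) = 0 then (1 : ℂ) else 0) = c
  rw [if_pos rfl, smul_eq_mul, mul_one]

open Classical in
theorem vertexPoint_single_of_ne {S : Type*} [AddCommMonoid S]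
    (hS : ∀ s t : S, s + t = 0 ↔ s = 0 ∧ t = 0) {s : S} (hs : s ≠ 0) (c : ℂ) :
    vertexPoint hS (AddMonoidAlgebra.single s c) = 0 := by
  unfold vertexPoint
  rw [AddMonoidAlgebra.lift_single]
  change c • (if s = 0 then (1 : ℂ) else 0) = 0
  rw [if_neg hs, smul_zero]

/-- A free commutative monoid has no units besides `0`, so the point killing all nontrivial
monomials exists. The torus only rescales monomials and fixes the constant one. -/
theorem hasTorusFixedPoint_of_free {M : AddSubgroup LMono} {S : AddSubmonoid M}
    (e : S ≃+ (Fin 3 →₀ ℕ)) : HasTorusFixedPoint S := by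
  have hS : ∀ s t : S, s + t = 0 ↔ s = 0 ∧ t = 0 := by
    intro s t
    rw [← e.map_eq_zero_iff, map_add, add_eq_zero, e.map_eq_zero_iff, e.map_eq_zero_iff]
  refine ⟨vertexPoint hS, fun t => AddMonoidAlgebra.algHom_ext (fun s => ?_) (by ext)⟩
  rw [AlgHom.comp_apply, torusAct_single]
  by_cases hs : s = 0
  · subst hs
    rw [vertexPoint_single_zero, vertexPoint_single_zero]
    exact congrArg Units.val (map_one t)
  · rw [vertexPoint_single_of_ne hS hs, vertexPoint_single_of_ne hS hs]

theorem smooth_affineToric_of_free {M : AddSubgroup LMono} {S : AddSubmonoid M}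
    (e : S ≃+ (Fin 3 →₀ ℕ)) : Smooth (affineToric S).hom := by
  have : Algebra.Smooth ℂ (MvPolynomial (Fin 3) ℂ) := {}
  have h : Algebra.Smooth ℂ (AddMonoidAlgebra ℂ S) :=
    Algebra.Smooth.of_equiv (AddMonoidAlgebra.domCongr ℂ ℂ e).symm
  change Smooth (Spec.map (CommRingCat.ofHom (algebraMap ℂ (AddMonoidAlgebra ℂ S))))
  rw [HasRingHomProperty.Spec_iff (P := @Smooth)]
  exact RingHom.smooth_algebraMap.2 h

/-! ## Star subdivisions and gluing of fans -/

theorem orthantFan_eq : orthantFan = Set.range stdCone := by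
  ext τ
  exact ⟨fun ⟨I, h⟩ => ⟨I, h.symm⟩, fun ⟨I, h⟩ => ⟨I, h.symm⟩⟩

theorem mem_map_subdivMap {r : ℕ} (hr : 0 < r) {α : Fin 3 → ℤ} {j : Fin 3} (hj : 0 < α j)
    {σ : PointedCone ℝ LR} {u : LR} :
    subdivMap r α j u ∈ σ.map (subdivMap r α j) ↔ u ∈ σ :=
  ⟨fun ⟨_, hw, h⟩ => subdivMap_injective hr hj h ▸ hw, fun h => ⟨u, h, rfl⟩⟩

theorem map_subdivMap_le {r : ℕ} (hr : 0 < r) {α : Fin 3 → ℤ} {j : Fin 3} (hj : 0 < α j)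
    {σ τ : PointedCone ℝ LR} :
    σ.map (subdivMap r α j) ≤ τ.map (subdivMap r α j) ↔ σ ≤ τ :=
  ⟨fun h _ hu => (mem_map_subdivMap hr hj).1 (h ⟨_, hu, rfl⟩), fun h => Submodule.map_mono h⟩

theorem map_hull (f : LR →ₗ[ℝ] LR) (s : Set LR) :
    (PointedCone.hull ℝ s).map f = PointedCone.hull ℝ (f '' s) :=
  Submodule.map_span _ _

theorem map_stdCone (f : LR →ₗ[ℝ] LR) (I : Set (Fin 3)) :
    (stdCone I).map f = PointedCone.hull ℝ ((fun i => f (Pi.single i 1)) '' I) := by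
  rw [stdCone, map_hull, Set.image_image]

theorem stdCone_mono {I J : Set (Fin 3)} (h : I ⊆ J) : stdCone I ≤ stdCone J :=
  Submodule.span_mono (Set.image_mono h)

theorem map_stdCone_of_notMem (r : ℕ) (α : Fin 3 → ℤ) {j : Fin 3} {I : Set (Fin 3)} (hj : j ∉ I) :
    (stdCone I).map (subdivMap r α j) = stdCone I := by
  rw [map_stdCone, stdCone]
  congr 1
  exact Set.image_congr fun i hi => subdivMap_single_of_ne r α fun h => hj (h ▸ hi)

theorem map_stdCone_insert (r : ℕ) (α : Fin 3 → ℤ) {j : Fin 3} {I : Set (Fin 3)} (hj : j ∉ I) :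
    (stdCone (insert j I)).map (subdivMap r α j) =
      stdCone I ⊔ PointedCone.hull ℝ {fun i => (α i : ℝ) / r} := by
  rw [map_stdCone, Set.image_insert_eq, subdivMap_single_self, Set.insert_eq, sup_comm]
  rw [show (fun i => subdivMap r α j (Pi.single i 1)) '' I = (fun i => (Pi.single i 1 : LR)) '' I
    from Set.image_congr fun i hi => subdivMap_single_of_ne r α fun h => hj (h ▸ hi)]
  exact Submodule.span_union _ _

/-- The charts `i` and `j` meet along the wall spanned by `α / r` and the remaining basis vector. A
face in this wall belongs to both charts, with the ray `α / r` carrying index `i` in one and `j` in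
the other. -/
theorem map_stdCone_swap (r : ℕ) (α : Fin 3 → ℤ) {i j : Fin 3} (hij : i ≠ j) {I : Set (Fin 3)}
    (hj : j ∉ I) :
    ∃ J : Set (Fin 3), i ∉ J ∧
      (stdCone I).map (subdivMap r α i) = (stdCone J).map (subdivMap r α j) := by
  by_cases hi : i ∈ I
  · refine ⟨insert j (I \ {i}), by simp [hij], ?_⟩
    rw [map_stdCone_insert r α (fun h => hj h.1), ← map_stdCone_insert r α (j := i) (by simp),
      Set.insert_sdiff_singleton, Set.insert_eq_of_mem hi]
  · exact ⟨I, hi, by rw [map_stdCone_of_notMem r α hi, map_stdCone_of_notMem r α hj]⟩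

/-- A fan subdividing the orthant without subdividing its proper faces. -/
structure IsInnerSubdivision (F : Set (PointedCone ℝ LR)) : Prop where
  le : ∀ τ ∈ F, τ ≤ stdCone Set.univ
  mem : ∀ I ≠ Set.univ, stdCone I ∈ F
  eq_stdCone : ∀ τ ∈ F, ∀ i, (∀ u ∈ τ, u i = 0) → ∃ I, i ∉ I ∧ τ = stdCone I

theorem isInnerSubdivision_orthantFan : IsInnerSubdivision orthantFan where
  le := by
    rintro τ ⟨I, rfl⟩
    exact stdCone_mono (Set.subset_univ I)
  mem I _ := ⟨I, rfl⟩
  eq_stdCone := by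
    rintro τ ⟨I, rfl⟩ i hi
    refine ⟨I, fun h => ?_, rfl⟩
    have := hi _ (Submodule.subset_span ⟨i, h, rfl⟩)
    simp at this

theorem IsInnerSubdivision.starSubdivision {F : Set (PointedCone ℝ LR)}
    (hF : IsInnerSubdivision F) {v : LR} (hv : ∀ i, 0 < v i) :
    IsInnerSubdivision (starSubdivision F v) where
  le := by
    rintro τ (⟨hτ, -⟩ | ⟨τ, hτ, -, -, rfl⟩)
    · exact hF.le τ hτ
    · refine sup_le (hF.le τ hτ) (Submodule.span_le.2 (Set.singleton_subset_iff.2 ?_))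
      exact mem_stdCone_univ.2 fun i => (hv i).le
  mem I hI := by
    obtain ⟨i, hi⟩ := (Set.ne_univ_iff_exists_notMem I).1 hI
    exact Or.inl ⟨hF.mem I hI, fun h => (hv i).ne' ((mem_stdCone.1 h i).2 hi)⟩
  eq_stdCone := by
    rintro τ (⟨hτ, -⟩ | ⟨τ, hτ, -, -, rfl⟩) i hi
    · exact hF.eq_stdCone τ hτ i hi
    · exact absurd (hi v (Submodule.mem_sup_right (Submodule.subset_span rfl))) (hv i).ne'

/-- The fan obtained from the star subdivision of the orthant at `α / r` by subdividing the
three maximal cones. -/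
def glue (r : ℕ) (α : Fin 3 → ℤ) (F : Fin 3 → Set (PointedCone ℝ LR)) : Set (PointedCone ℝ LR) :=
  {τ | ∃ j, ∃ σ ∈ F j, τ = σ.map (subdivMap r α j)}

theorem starSubdivision_orthantFan {r : ℕ} (hr : 0 < r) {α : Fin 3 → ℤ} (hα : ∀ i, 0 < α i) :
    starSubdivision orthantFan (fun i => (α i : ℝ) / r) = glue r α fun _ => orthantFan := by
  have hv : ∀ i, (0 : ℝ) < (α i : ℝ) / r := fun i =>
    div_pos (by exact_mod_cast hα i) (by exact_mod_cast hr)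
  have hmem : ∀ I, (fun i => (α i : ℝ) / r) ∈ stdCone I ↔ I = Set.univ := by
    intro I
    refine ⟨fun h => Set.eq_univ_of_forall fun i => ?_, ?_⟩
    · by_contra hi
      exact (hv i).ne' ((mem_stdCone.1 h i).2 hi)
    · rintro rfl
      exact mem_stdCone_univ.2 fun i => (hv i).le
  rw [orthantFan_eq]
  ext ρ
  constructor
  · rintro (⟨⟨I, rfl⟩, h⟩ | ⟨_, ⟨I, rfl⟩, h, -, rfl⟩)
    · rw [hmem] at h
      obtain ⟨i, hi⟩ := (Set.ne_univ_iff_exists_notMem I).1 h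
      exact ⟨i, _, ⟨I, rfl⟩, (map_stdCone_of_notMem r α hi).symm⟩
    · rw [hmem] at h
      obtain ⟨i, hi⟩ := (Set.ne_univ_iff_exists_notMem I).1 h
      exact ⟨i, _, ⟨_, rfl⟩, (map_stdCone_insert r α hi).symm⟩
  · rintro ⟨j, _, ⟨I, rfl⟩, rfl⟩
    by_cases hj : j ∈ I
    · right
      have hI : I \ {j} ≠ Set.univ := fun h => by
        have : j ∈ I \ {j} := h ▸ trivial
        exact this.2 rfl
      refine ⟨stdCone (I \ {j}), ⟨_, rfl⟩, by rwa [hmem], ⟨stdCone Set.univ, ⟨_, rfl⟩,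
        stdCone_mono (Set.subset_univ _), (hmem _).2 rfl⟩, ?_⟩
      rw [← map_stdCone_insert r α (j := j) (by simp), Set.insert_sdiff_singleton,
        Set.insert_eq_of_mem hj]
    · left
      rw [map_stdCone_of_notMem r α hj]
      refine ⟨⟨_, rfl⟩, fun h => hj ?_⟩
      rw [(hmem I).1 h]
      trivial

/-- The linear form separating the `i`-th and `j`-th cones of the star subdivision. -/
theorem separating_form {r : ℕ} (hr : 0 < r) {α : Fin 3 → ℤ} {i j : Fin 3} (hij : i ≠ j) (u : LR) :
    (α j : ℝ) * subdivMap r α i u i - α i * subdivMap r α i u j = -(α i * u j) := by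
  have hr' : (r : ℝ) ≠ 0 := by positivity
  rw [subdivMap_apply, subdivMap_apply, if_pos rfl, if_neg hij.symm]
  field_simp
  ring

/-- The form of `separating_form` is nonpositive on one chart and nonnegative on the other, hence
zero at a common point. -/
theorem apply_eq_zero_of_map_eq {r : ℕ} (hr : 0 < r) {α : Fin 3 → ℤ} (hα : ∀ i, 0 < α i)
    {i j : Fin 3} (hij : i ≠ j) {u w : LR} (hu : 0 ≤ u) (hw : 0 ≤ w)
    (h : subdivMap r α i u = subdivMap r α j w) : u j = 0 := by
  have h1 := separating_form hr (α := α) hij u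
  have h2 := separating_form hr (α := α) hij.symm w
  rw [h] at h1
  have hi : (0 : ℝ) < α i := by exact_mod_cast hα i
  have hj : (0 : ℝ) < α j := by exact_mod_cast hα j
  have h3 := hu j
  have h4 := hw i
  simp only [Pi.zero_apply] at h3 h4
  have h5 : (α i : ℝ) * u j = 0 := by
    have := mul_nonneg hi.le h3
    have := mul_nonneg hj.le h4
    linarith
  exact (mul_eq_zero.1 h5).resolve_left hi.ne'

/-- A centre interior to chart `j` lies in no cone of another chart. A cone of another chart that is
a candidate for joining with it must lie on a common wall; walls are not subdivided, so that cone is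
already one of chart `j` (`hcommon`). -/
theorem starSubdivision_glue {r : ℕ} (hr : 0 < r) {α : Fin 3 → ℤ} (hα : ∀ i, 0 < α i)
    {F : Fin 3 → Set (PointedCone ℝ LR)} (hF : ∀ i, IsInnerSubdivision (F i)) (j : Fin 3) {v : LR}
    (hv : ∀ i, 0 < v i) :
    starSubdivision (glue r α F) (subdivMap r α j v) =
      glue r α (Function.update F j (starSubdivision (F j) v)) := by
  have hnot : ∀ i ≠ j, ∀ τ ∈ F i, subdivMap r α j v ∉ τ.map (subdivMap r α i) := by
    rintro i hi τ hτ ⟨u, hu, h⟩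
    exact (hv i).ne' (apply_eq_zero_of_map_eq hr hα hi.symm (fun i => (hv i).le)
      (mem_stdCone_univ.1 ((hF i).le τ hτ hu)) h.symm)
  have hcommon : ∀ i, ∀ τ ∈ F i, ∀ σ ∈ F j, τ.map (subdivMap r α i) ≤ σ.map (subdivMap r α j) →
      ∃ τ' ∈ F j, τ.map (subdivMap r α i) = τ'.map (subdivMap r α j) := by
    intro i τ hτ σ hσ hle
    by_cases hi : i = j
    · subst hi; exact ⟨τ, hτ, rfl⟩
    · obtain ⟨I, hI, rfl⟩ := (hF i).eq_stdCone τ hτ j fun u hu => by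
        obtain ⟨w, hw, h⟩ := hle ⟨u, hu, rfl⟩
        exact apply_eq_zero_of_map_eq hr hα hi (mem_stdCone_univ.1 ((hF i).le _ hτ hu))
          (mem_stdCone_univ.1 ((hF j).le _ hσ hw)) h.symm
      obtain ⟨J, hJ, h⟩ := map_stdCone_swap r α hi hI
      exact ⟨_, (hF j).mem J (fun h => hJ (h ▸ trivial)), h⟩
  have hsup : ∀ τ : PointedCone ℝ LR,
      τ.map (subdivMap r α j) ⊔ PointedCone.hull ℝ {subdivMap r α j v} =
        (τ ⊔ PointedCone.hull ℝ {v}).map (subdivMap r α j) := by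
    intro τ
    rw [← Set.image_singleton, ← map_hull]
    exact (Submodule.map_sup _ _ _).symm
  ext ρ
  constructor
  · rintro (⟨⟨i, τ, hτ, rfl⟩, hvτ⟩ | ⟨_, ⟨i, τ, hτ, rfl⟩, hvτ, ⟨_, ⟨k, σ, hσ, rfl⟩, hle, hvσ⟩, rfl⟩)
    · refine ⟨i, τ, ?_, rfl⟩
      by_cases hi : i = j
      · subst hi
        rw [Function.update_self]
        exact Or.inl ⟨hτ, fun h => hvτ ⟨v, h, rfl⟩⟩
      · rwa [Function.update_of_ne hi]
    · have hk : k = j := by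
        by_contra hk
        exact hnot k hk σ hσ hvσ
      subst hk
      obtain ⟨τ', hτ', h⟩ := hcommon i τ hτ σ hσ hle
      rw [h] at hvτ hle ⊢
      refine ⟨k, τ' ⊔ PointedCone.hull ℝ {v}, ?_, hsup τ'⟩
      rw [Function.update_self]
      exact Or.inr ⟨τ', hτ', fun h => hvτ ⟨v, h, rfl⟩, ⟨σ, hσ, (map_subdivMap_le hr (hα k)).1 hle,
        (mem_map_subdivMap hr (hα k)).1 hvσ⟩, rfl⟩
  · rintro ⟨i, τ, hτ, rfl⟩
    by_cases hi : i = j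
    · subst hi
      rw [Function.update_self] at hτ
      rcases hτ with ⟨hτ, hvτ⟩ | ⟨τ, hτ, hvτ, ⟨σ, hσ, hle, hvσ⟩, rfl⟩
      · exact Or.inl ⟨⟨i, τ, hτ, rfl⟩, fun h => hvτ ((mem_map_subdivMap hr (hα i)).1 h)⟩
      · exact Or.inr ⟨_, ⟨i, τ, hτ, rfl⟩, fun h => hvτ ((mem_map_subdivMap hr (hα i)).1 h),
          ⟨_, ⟨i, σ, hσ, rfl⟩, (map_subdivMap_le hr (hα i)).2 hle, ⟨v, hvσ, rfl⟩⟩, (hsup τ).symm⟩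
    · rw [Function.update_of_ne hi] at hτ
      exact Or.inl ⟨⟨i, τ, hτ, rfl⟩, hnot i hi τ hτ⟩

/-! ## Recursion for the economic resolution -/

theorem econPoint_eq {r a i : ℕ} {s t : ℤ} (hs : (a * i : ℤ) % (r : ℤ) = s)
    (ht : (r - a * i : ℤ) % (r : ℤ) = t) :
    econPoint r a i = ![(i : ℝ) / r, (s : ℝ) / r, (t : ℝ) / r] := by
  rw [econPoint, hs, ht]

theorem emod_eq_of_eq_add_mul {x r s k : ℤ} (h0 : 0 ≤ s) (h1 : s < r) (h : x = s + r * k) :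
    x % r = s := by
  rw [h, Int.add_mul_emod_self_left, Int.emod_eq_of_lt h0 h1]

/-- The `n`-th centre, in terms of the quotient `q` and the remainder `s` of `a n` by `r`. -/
theorem econPoint_of_remainder {r a n : ℕ} {s q : ℤ} (h0 : 0 < s) (h1 : s < r)
    (h : (a * n : ℤ) = r * q + s) :
    econPoint r a n = ![(n : ℝ) / r, (s : ℝ) / r, ((r : ℝ) - s) / r] := by
  rw [econPoint_eq (s := s) (t := r - s) (emod_eq_of_eq_add_mul h0.le h1 (k := q) (by linarith))
    (emod_eq_of_eq_add_mul (k := -q) (by linarith) (by linarith) (by rw [h]; ring))]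
  push_cast
  rfl

theorem danilovType_pos {r a : ℕ} (h0 : 0 < a) (h1 : a < r) (i : Fin 3) :
    0 < danilovType r a i := by
  fin_cases i
  · exact zero_lt_one
  · change (0 : ℤ) < a; exact_mod_cast h0
  · change (0 : ℤ) < r - a
    have : (a : ℤ) < r := by exact_mod_cast h1
    linarith

theorem econPoint_one {r a : ℕ} (h0 : 0 < a) (h1 : a < r) :
    econPoint r a 1 = fun i => (danilovType r a i : ℝ) / r := by
  rw [econPoint_of_remainder (s := a) (q := 0) (by exact_mod_cast h0) (by exact_mod_cast h1)
    (by simp)]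
  funext i
  fin_cases i <;> simp [danilovType]

theorem subdivMap_one_apply (r a : ℕ) (x y z : ℝ) :
    subdivMap r (danilovType r a) 1 ![x, y, z] =
      ![x + y / r, y * a / r, z + y * ((r - a) / r)] := by
  funext i
  fin_cases i <;> simp [subdivMap_apply, danilovType] <;> ring

theorem subdivMap_two_apply (r a : ℕ) (x y z : ℝ) :
    subdivMap r (danilovType r a) 2 ![x, y, z] =
      ![x + z / r, y + z * a / r, z * ((r - a) / r)] := by
  funext i
  fin_cases i <;> simp [subdivMap_apply, danilovType] <;> ring

theorem econPoint_left {r a b n q : ℕ} {s : ℤ} (h1 : a < r)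
    (hb : (b : ℤ) ≡ -r [ZMOD a]) (hs0 : 0 < s) (hs : s < a) (h : (a * n : ℤ) = r * q + s) :
    econPoint r a n = subdivMap r (danilovType r a) 1 (econPoint a b q) ∧
      (0 < q → ∀ i, 0 < econPoint a b q i) := by
  have h0' : (0 : ℤ) < a := hs0.trans hs
  have h1' : (a : ℤ) < r := by exact_mod_cast h1
  obtain ⟨k, hk⟩ := hb.symm.dvd
  rw [econPoint_of_remainder hs0 (hs.trans h1') h,
    econPoint_of_remainder (q := k * q - n) hs0 hs (by linear_combination (q : ℤ) * hk + h),
    subdivMap_one_apply]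
  have e : (a * n : ℝ) = r * q + s := by exact_mod_cast h
  have ha : (0 : ℝ) < a := by exact_mod_cast h0'
  have hr : (0 : ℝ) < r := by exact_mod_cast h0'.trans h1'
  have hsR : (0 : ℝ) < s := by exact_mod_cast hs0
  have hsa : (0 : ℝ) < a - s := by rw [sub_pos]; exact_mod_cast hs
  constructor
  · funext i
    fin_cases i
    · change (n : ℝ) / r = q / a + s / a / r
      field_simp
      linear_combination e
    · change (s : ℝ) / r = s / a * a / r
      field_simp
    · change ((r : ℝ) - s) / r = (a - s) / a + s / a * ((r - a) / r)
      field_simp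
      ring
  · intro hq i
    have hq' : (0 : ℝ) < q := by exact_mod_cast hq
    fin_cases i
    · change 0 < (q : ℝ) / a
      positivity
    · change 0 < (s : ℝ) / a
      positivity
    · change 0 < ((a : ℝ) - s) / a
      positivity

/-- Since `c ≡ r` modulo `r - a`, and `r p = (r - a)(n - 1) + (s - a)` for `p = n - 1 - q`, the
residue of `c p` modulo `r - a` is `s - a`. -/
theorem econPoint_right {r a c n p q : ℕ} {s : ℤ} (h0 : 0 < a) (h1 : a < r)
    (hc : (c : ℤ) ≡ r [ZMOD (r - a : ℤ)]) (hs0 : a < s) (hs : s < r)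
    (h : (a * n : ℤ) = r * q + s) (hn : n = p + 1 + q) :
    econPoint r a n = subdivMap r (danilovType r a) 2 (econPoint (r - a) c p) ∧
      (0 < p → ∀ i, 0 < econPoint (r - a) c p i) := by
  have h0' : (0 : ℤ) < a := by exact_mod_cast h0
  have hcast : ((r - a : ℕ) : ℤ) = r - a := Nat.cast_sub h1.le
  have hcastR : ((r - a : ℕ) : ℝ) = r - a := Nat.cast_sub h1.le
  obtain ⟨k, hk⟩ := hc.symm.dvd
  have hn' : (n : ℤ) = p + 1 + q := by exact_mod_cast hn
  rw [econPoint_of_remainder (h0'.trans hs0) hs h,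
    econPoint_of_remainder (s := s - a) (q := k * p + n - 1) (by linarith) (by linarith) (by
      rw [hcast]
      linear_combination (p : ℤ) * hk - (r : ℤ) * hn' + h), hcastR, subdivMap_two_apply]
  have e : (a * n : ℝ) = r * q + s := by exact_mod_cast h
  have hnR : (n : ℝ) = p + 1 + q := by exact_mod_cast hn
  have ha : (0 : ℝ) < a := by exact_mod_cast h0
  have hra : (0 : ℝ) < r - a := by rw [sub_pos]; exact_mod_cast h1
  have hr : (0 : ℝ) < r := by linarith
  have hsa : (0 : ℝ) < s - a := by rw [sub_pos]; exact_mod_cast hs0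
  have hsr : (0 : ℝ) < r - s := by rw [sub_pos]; exact_mod_cast hs
  constructor
  · funext i
    fin_cases i
    · change (n : ℝ) / r = p / (r - a) + (r - a - ((s - a : ℤ) : ℝ)) / (r - a) / r
      push_cast
      field_simp
      linear_combination (r : ℝ) * hnR - e
    · change (s : ℝ) / r = ((s - a : ℤ) : ℝ) / (r - a) +
        (r - a - ((s - a : ℤ) : ℝ)) / (r - a) * a / r
      push_cast
      field_simp
      ring
    · change ((r : ℝ) - s) / r = (r - a - ((s - a : ℤ) : ℝ)) / (r - a) * ((r - a) / r)
      push_cast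
      field_simp
      ring
  · intro hp i
    have hp' : (0 : ℝ) < p := by exact_mod_cast hp
    fin_cases i
    · change 0 < (p : ℝ) / (r - a)
      positivity
    · change 0 < ((s - a : ℤ) : ℝ) / (r - a)
      push_cast
      positivity
    · change 0 < (r - a - ((s - a : ℤ) : ℝ)) / (r - a)
      push_cast
      rw [sub_sub_sub_cancel_right]
      positivity

/-- The first blowup creates the charts. Afterwards the residue `s` of `a n` modulo `r` decides: `s
< a` means the quotient has just grown and the left chart is blown up, `s > a` means it has not and
the right chart is blown up. The central chart is never touched. -/
theorem blowupFan_succ {r a b c : ℕ} (h0 : 0 < a) (h1 : a < r) (hra : Nat.Coprime r a)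
    (hb : (b : ℤ) ≡ -r [ZMOD a]) (hc : (c : ℤ) ≡ r [ZMOD (r - a : ℤ)]) (k : ℕ) (hk : k + 1 < r) :
    ∃ F : Fin 3 → Set (PointedCone ℝ LR), (∀ i, IsInnerSubdivision (F i)) ∧
      F = ![orthantFan, blowupFan a b (a * (k + 1) / r),
        blowupFan (r - a) c (k - a * (k + 1) / r)] ∧
      blowupFan r a (k + 1) = glue r (danilovType r a) F := by
  have hr : 0 < r := h0.trans h1
  induction k with
  | zero =>
    refine ⟨fun _ => orthantFan, fun _ => isInnerSubdivision_orthantFan, ?_, ?_⟩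
    · rw [zero_add, mul_one, Nat.div_eq_of_lt h1]
      funext i
      fin_cases i <;> rfl
    · rw [← starSubdivision_orthantFan hr (danilovType_pos h0 h1), ← econPoint_one h0 h1]
      rfl
  | succ k ih =>
    obtain ⟨F, hF, hFe, hglue⟩ := ih (by omega)
    set n := k + 1 + 1 with hn
    set q := a * n / r with hq
    set s := a * n % r with hs
    have hqs : r * q + s = a * n := Nat.div_add_mod _ _
    have hsr : s < r := Nat.mod_lt _ hr
    have hmod : s = 0 → r ∣ a * n := Nat.dvd_of_mod_eq_zero
    clear_value q s
    have hndvd : ∀ l, 0 < l → l < r → ¬ r ∣ a * l := fun l hl hlr hd =>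
      absurd (Nat.le_of_dvd hl (hra.dvd_of_dvd_mul_left hd)) (by omega)
    have hs0 : 0 < s := Nat.pos_of_ne_zero fun h =>
      hndvd n (by omega) hk (hmod h)
    have han : a * n = a * (k + 1) + a := by rw [hn]; ring
    have hqs' : (a * n : ℤ) = r * q + (s : ℤ) := by exact_mod_cast hqs.symm
    have hsucc : blowupFan r a n =
        starSubdivision (glue r (danilovType r a) F) (econPoint r a n) := by
      rw [← hglue, hn]; rfl
    rcases lt_or_ge s a with hsa | hsa
    · have hq0 : 0 < q := by
        by_contra hq0
        have : q = 0 := by omega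
        rw [this, mul_zero] at hqs
        have : 0 < a * (k + 1) := by positivity
        omega
      have hold : a * (k + 1) / r = q - 1 := by
        obtain ⟨q', hq'⟩ : ∃ q', q = q' + 1 := ⟨q - 1, by omega⟩
        rw [hq', mul_add, mul_one] at hqs
        rw [hq', Nat.add_sub_cancel, Nat.div_eq_iff hr]
        rw [mul_comm q' r]
        omega
      obtain ⟨hpt, hpos⟩ := econPoint_left h1 hb (by exact_mod_cast hs0) (by exact_mod_cast hsa) hqs'
      have hpos := hpos hq0
      refine ⟨Function.update F 1 (starSubdivision (F 1) (econPoint a b q)), ?_, ?_, ?_⟩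
      rotate_left 2
      · rw [hsucc, hpt]
        exact starSubdivision_glue hr (danilovType_pos h0 h1) hF 1 hpos
      · intro i
        by_cases hi : i = 1
        · subst hi
          rw [Function.update_self]
          exact (hF 1).starSubdivision hpos
        · rw [Function.update_of_ne hi]
          exact hF i
      · rw [hFe, hold]
        funext i
        fin_cases i
        · rfl
        · change starSubdivision (blowupFan a b (q - 1)) (econPoint a b q) = blowupFan a b q
          obtain ⟨q', hq'⟩ : ∃ q', q = q' + 1 := ⟨q - 1, by omega⟩
          rw [hq']; rfl
        · change blowupFan (r - a) c (k - (q - 1)) = blowupFan (r - a) c (k + 1 - q)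
          congr 1; omega
    · have hsa' : a < s := by
        -- Equality `s = a` would make `r` divide `a (n - 1)`, against coprimality.
        refine lt_of_le_of_ne hsa fun h => hndvd (k + 1) (by omega) (by omega) ⟨q, ?_⟩
        omega
      have hold : a * (k + 1) / r = q := by
        rw [Nat.div_eq_iff hr, mul_comm q r]
        omega
      have hqk : q < k + 1 := by
        rw [← hold, Nat.div_lt_iff_lt_mul hr, mul_comm]
        exact Nat.mul_lt_mul_of_pos_left h1 (by omega)
      obtain ⟨hpt, hpos⟩ := econPoint_right (p := k + 1 - q) h0 h1 hc (by exact_mod_cast hsa')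
        (by exact_mod_cast hsr) hqs' (by omega)
      have hpos := hpos (by omega)
      refine ⟨Function.update F 2 (starSubdivision (F 2) (econPoint (r - a) c (k + 1 - q))), ?_, ?_, ?_⟩
      rotate_left 2
      · rw [hsucc, hpt]
        exact starSubdivision_glue hr (danilovType_pos h0 h1) hF 2 hpos
      · intro i
        by_cases hi : i = 2
        · subst hi
          rw [Function.update_self]
          exact (hF 2).starSubdivision hpos
        · rw [Function.update_of_ne hi]
          exact hF i
      · rw [hFe, hold]
        funext i
        fin_cases i
        · rfl
        · rfl
        · change starSubdivision (blowupFan (r - a) c (k - q)) (econPoint (r - a) c (k + 1 - q)) =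
            blowupFan (r - a) c (k + 1 - q)
          rw [show k + 1 - q = k - q + 1 by omega]; rfl

theorem econFan_eq_glue {r a b c : ℕ} (h0 : 0 < a) (h1 : a < r) (hra : Nat.Coprime r a)
    (hb : (b : ℤ) ≡ -r [ZMOD a]) (hc : (c : ℤ) ≡ r [ZMOD (r - a : ℤ)]) :
    econFan r a = glue r (danilovType r a) ![orthantFan, econFan a b, econFan (r - a) c] := by
  obtain ⟨k, rfl⟩ : ∃ k, r = k + 2 := ⟨r - 2, by omega⟩
  obtain ⟨F, -, hF, h⟩ := blowupFan_succ h0 h1 hra hb hc k (by omega)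
  -- After all `r - 1` blowups the left chart has received `a - 1` of them and the right chart `r -
  -- a - 1`, exactly the numbers of their own economic resolutions.
  have hq : a * (k + 1) / (k + 2) = a - 1 := by
    obtain ⟨a', rfl⟩ : ∃ a', a = a' + 1 := ⟨a - 1, by omega⟩
    rw [Nat.div_eq_iff (by omega), Nat.add_sub_cancel]
    constructor <;> ring_nf at * <;> omega
  rw [hq] at hF
  rw [econFan, show k + 2 - 1 = k + 1 by omega, h, hF]
  rw [show k - (a - 1) = k + 2 - a - 1 by omega]
  rfl

/-! ## The recursion tree -/

/-- The groups of type `(1/r')(1, a', r' - a')` of the three charts of the weighted blowup at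
`v_1` for the group of type `(1/r)(1, a, r - a)`. -/
inductive IsChart (r a : ℕ) : Fin 3 → ℕ → ℕ → Prop
  | central : IsChart r a 0 1 0
  | left (b : ℕ) (hb : b < a) (hbr : (b : ℤ) ≡ -r [ZMOD a]) : IsChart r a 1 a b
  | right (c : ℕ) (hc : c < r - a) (hcr : (c : ℤ) ≡ r [ZMOD (r - a : ℤ)]) :
      IsChart r a 2 (r - a) c

/-- The pairs of a maximal cone of the economic resolution and its Danilov brick. -/
inductive IsDanilovPair : ℕ → ℕ → PointedCone ℝ LR → Set LMono → Prop
  | trivial (a : ℕ) : IsDanilovPair 1 a (stdCone Set.univ) {0}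
  | step (r a : ℕ) (j : Fin 3) (r' a' : ℕ) (h0 : 0 < a) (h1 : a < r) (hc : IsChart r a j r' a')
      (σ : PointedCone ℝ LR) (Γ : Set LMono) (h : IsDanilovPair r' a' σ Γ) :
      IsDanilovPair r a (σ.map (subdivMap r (danilovType r a) j))
        (roundDown r (danilovType r a) j ⁻¹' Γ)

theorem eq_of_modEq {x y : ℕ} {n z : ℤ} (hx : (x : ℤ) < n) (hy : (y : ℤ) < n)
    (hxz : (x : ℤ) ≡ z [ZMOD n]) (hyz : (y : ℤ) ≡ z [ZMOD n]) : x = y := by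
  have h := hxz.trans hyz.symm
  rw [Int.ModEq, Int.emod_eq_of_lt (Int.natCast_nonneg _) hx,
    Int.emod_eq_of_lt (Int.natCast_nonneg _) hy] at h
  exact_mod_cast h

namespace IsChart

variable {r a : ℕ} {j : Fin 3} {r' a' : ℕ}

theorem unique (h : IsChart r a j r' a') {r'' a'' : ℕ} (h' : IsChart r a j r'' a'') :
    r'' = r' ∧ a'' = a' := by
  cases h with
  | central => cases h'; exact ⟨rfl, rfl⟩
  | left b hb hbr =>
    cases h' with
    | left b' hb' hbr' =>
      exact ⟨rfl, eq_of_modEq (by exact_mod_cast hb') (by exact_mod_cast hb) hbr' hbr⟩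
  | right c hc hcr =>
    cases h' with
    | right c' hc' hcr' => exact ⟨rfl, eq_of_modEq (by omega) (by omega) hcr' hcr⟩

theorem pos (h : IsChart r a j r' a') : 0 < r' := by
  cases h <;> omega

theorem lt (h0 : 0 < a) (h1 : a < r) (h : IsChart r a j r' a') : r' < r := by
  cases h <;> omega

theorem le (h : IsChart r a j r' a') : a' ≤ r' := by
  cases h <;> omega

theorem coprime (h1 : a < r) (hra : Nat.Coprime r a) (h : IsChart r a j r' a') :
    Nat.Coprime r' a' := by
  cases h with
  | central => exact Nat.coprime_one_left 0
  | left _ hb hbr =>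
    obtain ⟨k, hk⟩ := hbr.symm.dvd
    rw [← Nat.isCoprime_iff_coprime] at hra ⊢
    obtain ⟨x, y, hxy⟩ := hra
    exact ⟨y + x * k, -x, by linear_combination hxy - x * hk⟩
  | right _ hc hcr =>
    obtain ⟨k, hk⟩ := hcr.symm.dvd
    have hcast : ((r - a : ℕ) : ℤ) = r - a := Nat.cast_sub h1.le
    rw [← Nat.isCoprime_iff_coprime] at hra ⊢
    obtain ⟨x, y, hxy⟩ := hra
    rw [hcast]
    exact ⟨-y - (x + y) * k, x + y, by linear_combination hxy + (x + y) * hk⟩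

end IsChart

theorem exists_isChart {r a : ℕ} (h0 : 0 < a) (h1 : a < r) (j : Fin 3) :
    ∃ r' a', IsChart r a j r' a' := by
  fin_cases j
  · exact ⟨1, 0, .central⟩
  · have ha : (0 : ℤ) < a := by exact_mod_cast h0
    have h := Int.emod_nonneg (-r : ℤ) ha.ne'
    have h' := Int.emod_lt_of_pos (-r : ℤ) ha
    exact ⟨a, ((-r : ℤ) % a).toNat, .left _ (by omega) (by
      rw [Int.toNat_of_nonneg h]; exact Int.mod_modEq _ _)⟩
  · exact ⟨r - a, r % (r - a), .right _ (Nat.mod_lt _ (by omega)) (by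
      rw [Int.natCast_mod, Nat.cast_sub h1.le]; exact Int.mod_modEq _ _)⟩

theorem dotProduct_danilovType (r a : ℕ) (m : LMono) :
    dotProduct (danilovType r a) m = m 0 + a * m 1 + (r - a) * m 2 := by
  simp [dotProduct, danilovType, Fin.sum_univ_three]

theorem roundDownCentral_eq (r a : ℕ) : roundDownCentral r a = roundDown r (danilovType r a) 0 := by
  funext m i
  rw [roundDown, dotProduct_danilovType]
  fin_cases i <;> rfl

theorem roundDownLeft_eq (r a : ℕ) : roundDownLeft r a = roundDown r (danilovType r a) 1 := by
  funext m i
  rw [roundDown, dotProduct_danilovType]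
  fin_cases i <;> rfl

theorem roundDownRight_eq (r a : ℕ) : roundDownRight r a = roundDown r (danilovType r a) 2 := by
  funext m i
  rw [roundDown, dotProduct_danilovType]
  fin_cases i <;> rfl

theorem IsDanilovPair.isDanilovBrick {r a : ℕ} {σ : PointedCone ℝ LR} {Γ : Set LMono}
    (h : IsDanilovPair r a σ Γ) : IsDanilovBrick r a Γ := by
  induction h with
  | trivial a => exact .trivial a
  | step r a j r' a' h0 h1 hc σ Γ h ih =>
    cases hc with
    | central =>
      rw [← roundDownCentral_eq]
      cases h with
      | trivial => exact .central r a h0 h1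
      -- The central chart has type `(1, 0)`, so it admits no further subdivision.
      | step _ _ _ _ _ h0' => omega
    | left _ hb hbr => rw [← roundDownLeft_eq]; exact .left r a a' h0 h1 hb hbr Γ ih
    | right _ hc hcr => rw [← roundDownRight_eq]; exact .right r a a' h0 h1 hc hcr Γ ih

theorem IsDanilovBrick.exists_pair {r a : ℕ} {Γ : Set LMono} (h : IsDanilovBrick r a Γ) :
    ∃ σ, IsDanilovPair r a σ Γ := by
  induction h with
  | trivial a => exact ⟨_, .trivial a⟩
  | central r a h0 h1 =>
    rw [roundDownCentral_eq]
    exact ⟨_, .step r a 0 1 0 h0 h1 .central _ _ (.trivial 0)⟩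
  | left r a b h0 h1 hb hbr Γ h ih =>
    obtain ⟨σ, hσ⟩ := ih
    rw [roundDownLeft_eq]
    exact ⟨_, .step r a 1 a b h0 h1 (.left b hb hbr) _ _ hσ⟩
  | right r a c h0 h1 hc hcr Γ h ih =>
    obtain ⟨σ, hσ⟩ := ih
    rw [roundDownRight_eq]
    exact ⟨_, .step r a 2 (r - a) c h0 h1 (.right c hc hcr) _ _ hσ⟩

theorem dvd_iff_of_dvd_add {n x y : ℤ} (h : n ∣ x + y) : n ∣ x ↔ n ∣ y :=
  ⟨fun hx => (dvd_add_right hx).1 h, fun hy => (dvd_add_left hy).1 h⟩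

/-- The shape `(1, a, r - a)` makes any two weights sum to at most `r`. The two divisibility
conditions describing the smaller lattice agree because the sum of the two expressions is a multiple
of the new order. -/
theorem IsChart.isRoundDown {r a : ℕ} (h0 : 0 < a) (h1 : a < r) {j : Fin 3} {r' a' : ℕ}
    (h : IsChart r a j r' a') :
    IsRoundDown (latticeM r (danilovType r a)) (latticeM r' (danilovType r' a'))
      (roundDown r (danilovType r a) j) := by
  have hpos := danilovType_pos h0 h1
  refine isRoundDown_roundDown (h0.trans h1) (fun i => (hpos i).le) (hpos j) ?_ ?_
  · intro i hi
    fin_cases i <;> fin_cases j <;> simp [danilovType] at hi ⊢ <;> omega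
  · intro g
    rw [mem_latticeM h.pos, dotProduct_danilovType, dotProduct_danilovType]
    cases h with
    | central => simp [danilovType]
    | left b hb hbr =>
      obtain ⟨k, hk⟩ := hbr.symm.dvd
      change (a : ℤ) ∣ _ ↔ (a : ℤ) ∣ r * g 1 - (_ - a * g 1)
      refine dvd_iff_of_dvd_add ?_
      exact ⟨k * g 1 + (2 - k) * g 2, by linear_combination (g 1 - g 2) * hk⟩
    | right c hc hcr =>
      obtain ⟨k, hk⟩ := hcr.symm.dvd
      rw [Nat.cast_sub h1.le]
      change (r - a : ℤ) ∣ _ ↔ (r - a : ℤ) ∣ r * g 2 - (_ - (r - a) * g 2)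
      refine dvd_iff_of_dvd_add ?_
      exact ⟨(1 + k) * g 1 + (1 - k) * g 2, by linear_combination (g 1 - g 2) * hk⟩

theorem IsDanilovPair.isBrickPair {r a : ℕ} {σ : PointedCone ℝ LR} {Γ : Set LMono}
    (h : IsDanilovPair r a σ Γ) : IsBrickPair r (danilovType r a) σ Γ := by
  induction h with
  | trivial a => exact isBrickPair_one _ rfl
  | step r a j r' a' h0 h1 hc σ Γ h ih =>
    have hpos := danilovType_pos h0 h1
    exact ih.subdiv (h0.trans h1) hc.pos (fun i => (hpos i).le) rfl (hpos j)
      (hc.isRoundDown h0 h1)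

theorem IsBrickPair.cone_eq {r : ℕ} {α : Fin 3 → ℤ} {σ₁ σ₂ : PointedCone ℝ LR} {Γ : Set LMono}
    (h₁ : IsBrickPair r α σ₁ Γ) (h₂ : IsBrickPair r α σ₂ Γ) : σ₁ = σ₂ := by
  have h := h₁.semigroup_eq.symm.trans h₂.semigroup_eq
  apply le_antisymm
  · exact fun u hu => h₂.mem_of_dual u fun m hm => (h ▸ hm : m ∈ dualSemigroup _ σ₁) u hu
  · exact fun u hu => h₁.mem_of_dual u fun m hm => (h ▸ hm : m ∈ dualSemigroup _ σ₂) u hu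

/-- A cone of chart `i` inside chart `j ≠ i` would lie in their common wall, which is impossible for
a full-dimensional cone. -/
theorem IsDanilovPair.index_eq_of_le {r a : ℕ} (h0 : 0 < a) (h1 : a < r) {i j : Fin 3}
    {r' a' : ℕ} {σ τ : PointedCone ℝ LR} {Γ : Set LMono} (h : IsDanilovPair r' a' σ Γ)
    (hτ : τ ≤ stdCone Set.univ)
    (hle : σ.map (subdivMap r (danilovType r a) i) ≤ τ.map (subdivMap r (danilovType r a) j)) :
    i = j := by
  by_contra hij
  have h2 := h.isBrickPair.full (LinearMap.proj j) fun u hu => by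
    obtain ⟨w, hw, he⟩ := hle ⟨u, hu, rfl⟩
    exact apply_eq_zero_of_map_eq (h0.trans h1) (danilovType_pos h0 h1) hij
      (mem_stdCone_univ.1 (h.isBrickPair.le hu)) (mem_stdCone_univ.1 (hτ hw)) he.symm
  have := LinearMap.congr_fun h2 (Pi.single j 1)
  simp at this

theorem IsDanilovPair.brick_eq {r a : ℕ} {σ : PointedCone ℝ LR} {Γ₁ Γ₂ : Set LMono}
    (h₁ : IsDanilovPair r a σ Γ₁) (h₂ : IsDanilovPair r a σ Γ₂) : Γ₁ = Γ₂ := by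
  obtain ⟨σ', hσ⟩ : ∃ σ', σ' = σ := ⟨σ, rfl⟩
  rw [← hσ] at h₂
  induction h₁ generalizing σ' Γ₂ with
  | trivial a =>
    cases h₂ with
    | trivial => rfl
    | step => omega
  | step r a j r' a' h0 h1 hc σ Γ h ih =>
    cases h₂ with
    | trivial => omega
    | step _ _ j₂ r₂ a₂ _ _ hc₂ σ₂ Γ₂ h₂ =>
      obtain rfl : j₂ = j := h₂.index_eq_of_le h0 h1 h.isBrickPair.le hσ.le
      obtain ⟨rfl, rfl⟩ := hc.unique hc₂
      have hj := danilovType_pos h0 h1 j₂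
      rw [ih _ h₂ (le_antisymm ((map_subdivMap_le (h0.trans h1) hj).1 hσ.le)
        ((map_subdivMap_le (h0.trans h1) hj).1 hσ.ge))]

/-! ## The maximal cones of the economic resolution -/

theorem econFan_eq_charts {r a : ℕ} (h0 : 0 < a) (h1 : a < r) (hra : Nat.Coprime r a)
    {r' a' : Fin 3 → ℕ} (h : ∀ j, IsChart r a j (r' j) (a' j)) :
    econFan r a = glue r (danilovType r a) fun j => econFan (r' j) (a' j) := by
  generalize ha1 : a' 1 = b, ha2 : a' 2 = c, hr1 : r' 1 = x, hr2 : r' 2 = y, ha3 : a' 0 = z,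
    hr3 : r' 0 = w
  have e : (fun j => econFan (r' j) (a' j)) = ![econFan w z, econFan x b, econFan y c] := by
    subst ha1 ha2 hr1 hr2 ha3 hr3
    funext j
    fin_cases j <;> rfl
  have c0 := h 0
  have c1 := h 1
  have c2 := h 2
  rw [ha3, hr3] at c0
  rw [ha1, hr1] at c1
  rw [ha2, hr2] at c2
  rw [e]
  cases c0 with
  | central =>
  cases c1 with
  | left _ hb hbr =>
  cases c2 with
  | right _ hc hcr => exact econFan_eq_glue h0 h1 hra hbr hcr

/-- Strong induction on `r` along the gluing of fans. Comparing two cones of the glued fan, the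
larger one containing a tree cone, forces them into one chart by `index_eq_of_le`; there the
induction hypothesis applies. -/
theorem econFan_pairs {r a : ℕ} (hr : 0 < r) (ha : a ≤ r) (hra : Nat.Coprime r a) :
    (∀ τ ∈ econFan r a, τ ≤ stdCone Set.univ ∧ ∃ σ Γ, IsDanilovPair r a σ Γ ∧ τ ≤ σ) ∧
    ∀ σ Γ, IsDanilovPair r a σ Γ → σ ∈ econFan r a ∧ ∀ τ ∈ econFan r a, σ ≤ τ → τ ≤ σ := by
  induction r using Nat.strong_induction_on generalizing a with
  | _ r ih =>
  by_cases hr1 : r = 1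
  · subst hr1
    have hle : ∀ τ ∈ econFan 1 a, τ ≤ stdCone Set.univ := by
      rintro τ ⟨I, rfl⟩
      exact stdCone_mono (Set.subset_univ I)
    refine ⟨fun τ hτ => ⟨hle τ hτ, _, _, .trivial a, hle τ hτ⟩, fun σ Γ h => ?_⟩
    cases h with
    | trivial => exact ⟨⟨Set.univ, rfl⟩, fun τ hτ _ => hle τ hτ⟩
    | step => omega
  · have h0 : 0 < a := Nat.pos_of_ne_zero fun h => hr1 (by
      rw [h] at hra; exact (Nat.coprime_zero_right r).1 hra)
    have h1 : a < r := lt_of_le_of_ne ha fun h => hr1 (by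
      rw [h] at hra; exact (Nat.coprime_self r).1 hra)
    choose r' a' hch using exists_isChart h0 h1
    have ih' := fun j => ih (r' j) ((hch j).lt h0 h1) (hch j).pos (hch j).le ((hch j).coprime h1 hra)
    have hpos := danilovType_pos h0 h1
    rw [econFan_eq_charts h0 h1 hra hch]
    constructor
    · rintro _ ⟨j, τ, hτ, rfl⟩
      obtain ⟨-, σ, Γ, hp, hle⟩ := (ih' j).1 τ hτ
      have hp' := IsDanilovPair.step r a j _ _ h0 h1 (hch j) σ Γ hp
      have hle' := (map_subdivMap_le hr (hpos j)).2 hle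
      exact ⟨hle'.trans hp'.isBrickPair.le, _, _, hp', hle'⟩
    · intro σ Γ hp
      cases hp with
      | trivial => exact absurd rfl hr1
      | step _ _ j r₂ a₂ _ _ hc σ Γ hp =>
        obtain ⟨rfl, rfl⟩ := (hch j).unique hc
        refine ⟨⟨j, σ, ((ih' j).2 σ Γ hp).1, rfl⟩, ?_⟩
        rintro _ ⟨i, τ, hτ, rfl⟩ hle
        obtain rfl := hp.index_eq_of_le h0 h1 ((ih' i).1 τ hτ).1 hle
        rw [map_subdivMap_le hr (hpos j)] at hle ⊢
        exact ((ih' j).2 σ Γ hp).2 τ hτ hle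

theorem mem_maxCones_iff {r a : ℕ} (hr : 0 < r) (ha : a ≤ r) (hra : Nat.Coprime r a)
    (σ : PointedCone ℝ LR) : σ ∈ maxCones r a ↔ ∃ Γ, IsDanilovPair r a σ Γ := by
  obtain ⟨h1, h2⟩ := econFan_pairs hr ha hra
  constructor
  · rintro ⟨hσ, hmax⟩
    obtain ⟨-, τ, Γ, hp, hle⟩ := h1 σ hσ
    have := le_antisymm hle (hmax (h2 τ Γ hp).1 hle)
    exact ⟨Γ, this ▸ hp⟩
  · rintro ⟨Γ, hp⟩
    exact ⟨(h2 σ Γ hp).1, fun τ hτ hle => (h2 σ Γ hp).2 τ hτ hle⟩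

end

end EconBrick

open EconBrick
theorem proposition4p3 (r a : ℕ) (hr : 0 < r) (ha : a ≤ r) (hra : Nat.Coprime r a) :
    (∀ Γ ∈ danilovBricks r a, IsGBrick r (danilovType r a) Γ) ∧
    ∃ Γ : PointedCone ℝ LR → Set LMono,
      Set.BijOn Γ (maxCones r a) (danilovBricks r a) ∧
      ∀ σ ∈ maxCones r a,
        semigroupS r (danilovType r a) (Γ σ)
            = dualSemigroup (latticeM r (danilovType r a)) σ ∧
        AlgebraicGeometry.Smooth (affineToric (dualSemigroup (latticeM r (danilovType r a)) σ)).hom ∧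
        Nonempty (affineToric (semigroupS r (danilovType r a) (Γ σ)) ≅
          affineToric (dualSemigroup (latticeM r (danilovType r a)) σ)) := by
  classical
  refine ⟨fun Γ hΓ => ?_, ?_⟩
  · obtain ⟨σ, hσ⟩ := IsDanilovBrick.exists_pair hΓ
    obtain ⟨e⟩ := hσ.isBrickPair.free
    refine ⟨hσ.isBrickPair.prebrick, ?_⟩
    rw [hσ.isBrickPair.semigroup_eq]
    exact hasTorusFixedPoint_of_free e
  · have hex : ∀ σ, ∃ Γ, σ ∈ maxCones r a → IsDanilovPair r a σ Γ := fun σ => by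
      by_cases h : σ ∈ maxCones r a
      · obtain ⟨Γ, hΓ⟩ := (mem_maxCones_iff hr ha hra σ).1 h
        exact ⟨Γ, fun _ => hΓ⟩
      -- The value away from the maximal cones is arbitrary.
      · exact ⟨∅, fun h' => absurd h' h⟩
    choose Γ hΓ using hex
    refine ⟨Γ, ⟨fun σ hσ => (hΓ σ hσ).isDanilovBrick, fun σ₁ h₁ σ₂ h₂ h => ?_, fun B hB => ?_⟩,
      fun σ hσ => ?_⟩
    · exact (h ▸ (hΓ σ₁ h₁).isBrickPair : IsBrickPair r (danilovType r a) σ₁ (Γ σ₂)).cone_eq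
        (hΓ σ₂ h₂).isBrickPair
    · obtain ⟨σ, hσ⟩ := IsDanilovBrick.exists_pair hB
      have hmem := (mem_maxCones_iff hr ha hra σ).2 ⟨B, hσ⟩
      exact ⟨σ, hmem, (hΓ σ hmem).brick_eq hσ⟩
    · have hp := (hΓ σ hσ).isBrickPair
      obtain ⟨e⟩ := hp.free
      refine ⟨hp.semigroup_eq, smooth_affineToric_of_free e, ?_⟩
      rw [hp.semigroup_eq]
      exact ⟨Iso.refl _⟩
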